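/- Let $v$ be a $C^2$ vector field on $\mathbb{R}^n$ (with a scalar product and its norm) generating a global flow $\{\chi^t\}_{t\in\mathbb{R}}$, and put $X^t(x)=\partial\chi^t(x)/\partial x$. Let $\mathcal{D}\subset\mathbb{R}^n$ be a domain containing a compact $C^1$ submanifold $\mathcal{M}$ of dimension $m<n$ which is invariant ($\chi^t(\mathcal{M})=\mathcal{M}$ for all $t\in\mathbb{R}$) and attracting ($\lim_{t\to\infty}\inf_{\xi\in\mathcal{M}}\|\chi^t(x)-\xi\|=0$ for all $x\in\mathcal{D}$). Assume that the flow is hyperbolic along $\mathcal{M}$: for every $x\in\mathcal{M}$ there is a direct sum decomposition $\mathbb{R}^n=\mathbb{L}^-_x\oplus\mathbb{L}^+_x\oplus\mathbb{L}^0_x$, where $\mathbb{L}^0_x$ is one-dimensional and spanned by $v(x)$, the subspaces $\mathbb{L}^\pm_x$ have dimensions independent of $x$ and depend continuously on $x\in\mathcal{M}$, $X^t(x)\mathbb{L}^\pm_x=\mathbb{L}^\pm_{\chi^t(x)}$ for all $t\in\mathbb{R}$, $x\in\mathcal{M}$, and there are constants $c\ge 1$, $\alpha>0$ such that for all $x\in\mathcal{M}$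 $$\|X^t(x)\eta\|\le c\,e^{-\alpha t}\|\eta\|\ (t\ge 0,\ \eta\in\mathbb{L}^-_x),\qquad \|X^t(x)\eta\|\le c\,e^{\alpha t}\|\eta\|\ (t\le 0,\ \eta\in\mathbb{L}^+_x),$$ where $c$ is taken so large that also $\|X^t(x)\eta\|\le c\|\eta\|$ for $t\in\mathbb{R}$, $\eta\in\mathbb{L}^0_x$. Let $P^{\pm,0}_x$ be the projections onto $\mathbb{L}^{\pm,0}_x$ associated with this decomposition and let $K=c\max\{\max_{x\in\mathcal{M}}\|P^-_x\|,\max_{x\in\mathcal{M}}\|P^+_x\|,\max_{x\in\mathcal{M}}\|P^0_x\|\}$. Let $w(t,y,\xi)=v(\chi^t(\xi)+y)-v(\chi^t(\xi))-v'(\chi^t(\xi))y$ and let $C>0$ be a constant such that $$\|w(t,y,\xi)\|\le\tfrac{C}{2}\|y\|^2,\quad \|w'_y(t,y,\xi)\|\le C\|y\|,\quad \|w''_{yy}(t,y,\xi)\|\le C\qquad\forall t\in\mathbb{R},\ \xi\in\mathcal{M},\ \|y\|\le 1.$$ For $r>0$ let $\mathcal{N}_r(\mathcal{M})=\{(\xi,\eta):\xi\in\mathcal{M},\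 \eta\in\mathbb{L}^-_\xi,\ \|\eta\|<r\}$. Let $r>0$ and $0<R<1$ satisfy $$c\,r+\frac{11}{6\alpha}KCR^2\le R\qquad\text{and}\qquad \frac{11}{3\alpha}KCR<1.$$ Then there exist a constant $C_0>0$ and a continuous mapping $h:\mathcal{N}_r(\mathcal{M})\to\mathbb{R}^n$ such that for every $(\xi,\eta)\in\mathcal{N}_r(\mathcal{M})$ one has $h(\xi,\eta)\in\mathbb{L}^+_\xi\oplus\mathbb{L}^0_\xi$, $\|h(\xi,\eta)\|\le C_0\|\eta\|^2$ and $$\|\chi^t(\xi+\eta+h(\xi,\eta))-\chi^t(\xi)\|\le R\,e^{-\alpha t}\qquad\forall t\ge 0,$$ and such that for each $\xi\in\mathcal{M}$ the mapping $\eta\mapsto h(\xi,\eta)$ is $C^2$ from $\{\eta\in\mathbb{L}^-_\xi:\|\eta\|<r\}$ to $\mathbb{L}^+_\xi\oplus\mathbb{L}^0_\xi$. -/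

import Mathlib

open Set Filter Topology

/-- `M` is an embedded `C¹` submanifold of dimension `m` of the finite-dimensional space `E`:
around every point of `M` there is a `C¹` diffeomorphism between open subsets of `E`
that straightens `M` into an `m`-dimensional linear subspace. -/
def IsC1Submanifold {E : Type*} [NormedAddCommGroup E] [InnerProductSpace ℝ E]
    (m : ℕ) (M : Set E) : Prop :=
  ∀ x ∈ M, ∃ (φ : OpenPartialHomeomorph E E) (W : Submodule ℝ E),
    x ∈ φ.source ∧ Module.finrank ℝ W = m ∧
    ContDiffOn ℝ 1 φ φ.source ∧ ContDiffOn ℝ 1 φ.symm φ.target ∧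
    ∀ y ∈ φ.source, y ∈ M ↔ φ y ∈ W

/-- The flow `χ` is generated by the vector field `v`. -/
def GeneratesFlow {E : Type*} [NormedAddCommGroup E] [InnerProductSpace ℝ E]
    (v : E → E) (χ : Flow ℝ E) : Prop :=
  ∀ (x : E) (t : ℝ), HasDerivAt (fun s : ℝ => χ s x) (v (χ t x)) t

/-- `X^t(x) = ∂χ^t(x)/∂x`. -/
noncomputable def flowDeriv {E : Type*} [NormedAddCommGroup E] [InnerProductSpace ℝ E]
    (χ : Flow ℝ E) (t : ℝ) (x : E) : E →L[ℝ] E :=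
  fderiv ℝ (fun y => χ t y) x

/-- `M` is a compact invariant `C¹` submanifold of dimension `m < dim E`, contained in the
domain `D` and attracting every point of `D`. -/
structure IsAttractingInvariantManifold {E : Type*} [NormedAddCommGroup E]
    [InnerProductSpace ℝ E] (χ : Flow ℝ E) (D M : Set E) (m : ℕ) : Prop where
  isOpen_domain : IsOpen D
  isConnected_domain : IsConnected D
  subset_domain : M ⊆ D
  isCompact : IsCompact M
  submanifold : IsC1Submanifold m M
  dim_lt : m < Module.finrank ℝ E
  invariant : ∀ t : ℝ, (fun x => χ t x) '' M = M
  attracting : ∀ x ∈ D, Tendsto (fun t : ℝ => Metric.infDist (χ t x) M) atTop (𝓝 0)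

/-- `𝕃⁰_x`, the subspace spanned by `v x`. -/
def neutralSpace {E : Type*} [NormedAddCommGroup E] [InnerProductSpace ℝ E]
    (v : E → E) (x : E) : Submodule ℝ E :=
  Submodule.span ℝ {v x}

/-- The flow `χ` of `v` is hyperbolic along `M`, with stable and unstable fields of planes
`Lm`, `Lp` (only their values on `M` matter) and with constants `c`, `α`. -/
structure IsHyperbolicAlong {E : Type*} [NormedAddCommGroup E] [InnerProductSpace ℝ E]
    [FiniteDimensional ℝ E] (v : E → E) (χ : Flow ℝ E) (M : Set E)
    (Lm Lp : E → Submodule ℝ E) (c α : ℝ) : Prop where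
  /-- `𝕃⁰_x` is one-dimensional. -/
  ne_zero : ∀ x ∈ M, v x ≠ 0
  /-- This condition and the two following ones say that `E` is the (internal) direct sum of
  `𝕃⁻_x`, `𝕃⁺_x` and `𝕃⁰_x`. -/
  isCompl_minus : ∀ x ∈ M, IsCompl (Lm x) (Lp x ⊔ neutralSpace v x)
  isCompl_plus : ∀ x ∈ M, IsCompl (Lp x) (Lm x ⊔ neutralSpace v x)
  isCompl_zero : ∀ x ∈ M, IsCompl (neutralSpace v x) (Lm x ⊔ Lp x)
  finrank_minus : ∃ k : ℕ, ∀ x ∈ M, Module.finrank ℝ (Lm x) = k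
  finrank_plus : ∃ k : ℕ, ∀ x ∈ M, Module.finrank ℝ (Lp x) = k
  /-- Continuity of a field of planes: the orthogonal projection onto the plane depends
  continuously on the point. -/
  continuousOn_minus : ContinuousOn (fun x => (Lm x).starProjection) M
  continuousOn_plus : ContinuousOn (fun x => (Lp x).starProjection) M
  map_minus : ∀ (t : ℝ), ∀ x ∈ M,
    (Lm x).map (flowDeriv χ t x : E →ₗ[ℝ] E) = Lm (χ t x)
  map_plus : ∀ (t : ℝ), ∀ x ∈ M,
    (Lp x).map (flowDeriv χ t x : E →ₗ[ℝ] E) = Lp (χ t x)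
  one_le : 1 ≤ c
  rate_pos : 0 < α
  estimate_minus : ∀ t : ℝ, 0 ≤ t → ∀ x ∈ M, ∀ η ∈ Lm x,
    ‖flowDeriv χ t x η‖ ≤ c * Real.exp (-α * t) * ‖η‖
  estimate_plus : ∀ t : ℝ, t ≤ 0 → ∀ x ∈ M, ∀ η ∈ Lp x,
    ‖flowDeriv χ t x η‖ ≤ c * Real.exp (α * t) * ‖η‖

open Classical in
/-- The projection of `E` onto `p` along `q` (zero if `p` and `q` are not complementary). -/
noncomputable def obliqueProj {E : Type*} [NormedAddCommGroup E] [InnerProductSpace ℝ E]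
    [FiniteDimensional ℝ E] (p q : Submodule ℝ E) : E →L[ℝ] E :=
  if h : IsCompl p q then LinearMap.toContinuousLinearMap (p.projection q h) else 0

/-- `K = c · max { max_{x ∈ M} ‖P^-_x‖, max_{x ∈ M} ‖P^+_x‖, max_{x ∈ M} ‖P^0_x‖ }`, where
`P^-_x`, `P^+_x`, `P^0_x` are the projections of the decomposition
`E = 𝕃⁻_x ⊕ 𝕃⁺_x ⊕ 𝕃⁰_x`. -/
noncomputable def greenConst {E : Type*} [NormedAddCommGroup E] [InnerProductSpace ℝ E]
    [FiniteDimensional ℝ E] (v : E → E) (M : Set E) (Lm Lp : E → Submodule ℝ E) (c : ℝ) : ℝ :=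
  c * sSup ((fun x => ‖obliqueProj (Lm x) (Lp x ⊔ neutralSpace v x)‖) '' M ∪
    (fun x => ‖obliqueProj (Lp x) (Lm x ⊔ neutralSpace v x)‖) '' M ∪
    (fun x => ‖obliqueProj (neutralSpace v x) (Lm x ⊔ Lp x)‖) '' M)

/-- `w(t, y, ξ) = v(χ^t(ξ) + y) - v(χ^t(ξ)) - v'(χ^t(ξ)) y`. -/
noncomputable def remainder {E : Type*} [NormedAddCommGroup E] [InnerProductSpace ℝ E]
    (v : E → E) (χ : Flow ℝ E) (t : ℝ) (y ξ : E) : E :=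
  v (χ t ξ + y) - v (χ t ξ) - fderiv ℝ v (χ t ξ) y

/-- The constant `C` bounds the remainder `w` and its first two derivatives in `y` on the
unit ball, uniformly in time and along `M`. -/
def IsRemainderBound {E : Type*} [NormedAddCommGroup E] [InnerProductSpace ℝ E]
    (v : E → E) (χ : Flow ℝ E) (M : Set E) (C : ℝ) : Prop :=
  ∀ t : ℝ, ∀ ξ ∈ M, ∀ y : E, ‖y‖ ≤ 1 →
    ‖remainder v χ t y ξ‖ ≤ C / 2 * ‖y‖ ^ 2 ∧
    ‖fderiv ℝ (fun z => remainder v χ t z ξ) y‖ ≤ C * ‖y‖ ∧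
    ‖fderiv ℝ (fderiv ℝ (fun z => remainder v χ t z ξ)) y‖ ≤ C

/-- `𝒩_r(M) = { (ξ, η) : ξ ∈ M, η ∈ 𝕃⁻_ξ, ‖η‖ < r }`. -/
def stableDiscBundle {E : Type*} [NormedAddCommGroup E] [InnerProductSpace ℝ E]
    (M : Set E) (Lm : E → Submodule ℝ E) (r : ℝ) : Set (E × E) :=
  {p | p.1 ∈ M ∧ p.2 ∈ Lm p.1 ∧ ‖p.2‖ < r}

/-! The method is that of Lyapunov and Perron. For x near ξ write χ^t(x) - χ^t(ξ) = e^{-αt} u(t)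
with u bounded on t ≥ 0. The remainder w is quadratic, so along this orbit it equals e^{-2αt}
S(u)(t) with S a superposition operator. Decay at infinity determines the unstable and neutral
components through integrals over (t, ∞), and the differential equation becomes u = a(η) + G(S(u)),
where a(η) is the weighted linear orbit of η ∈ 𝕃⁻_ξ and G is a Green operator with ‖G‖ ≤ 11K/(6α).
The factor e^{-2αt} makes the neutral direction harmless, although the linearised flow does not
contract there.

The two inequalities on r and R make the right-hand side a contraction of the ball ‖u‖ ≤ R, and h(ξ,
η) = G(S(u))(0). It has no stable component, and it is quadratic in η because u is of order ‖η‖ and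
S is quadratic. Fixed points in the ball correspond exactly to orbits approaching that of ξ within R
e^{-αt}: see `flow_sub_eq_of_eq_stableOrbit_add_green` and
`exists_eq_stableOrbit_add_green_of_flow_sub_le`.

Since orbits in M are bounded, S is C², and the inverse function theorem for id - G ∘ S gives C²
dependence on η (`contDiffOn_of_eq_add_clm_comp`). Joint continuity needs no study of how G varies
with ξ: h is bounded and is the only solution of conditions that survive passage to the limit. -/

open scoped BoundedContinuousFunction

/-! ### Superposition operators on bounded continuous functions -/

section Superposition

set_option linter.unusedSectionVars false

variable {T E F : Type*} [TopologicalSpace T] [NormedAddCommGroup E] [NormedSpace ℝ E]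
  [NormedAddCommGroup F] [NormedSpace ℝ F]

/-- The conditions on `g : T → E → F` under which `u ↦ (t ↦ g t (u t))` is a continuous
self-map of bounded continuous functions: `g` is jointly continuous and, on each ball of `E`,
bounded and uniformly continuous uniformly in `t`. -/
structure IsSuperposable (g : T → E → F) : Prop where
  continuous : Continuous fun p : T × E => g p.1 p.2
  bounded : ∀ ρ : ℝ, ∃ B : ℝ, ∀ t u, ‖u‖ ≤ ρ → ‖g t u‖ ≤ B
  equicont : ∀ ρ : ℝ, ∀ ε > 0, ∃ δ > 0, ∀ t u u', ‖u‖ ≤ ρ → ‖u'‖ ≤ ρ → ‖u - u'‖ < δ →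
    ‖g t u - g t u'‖ ≤ ε

/-- The superposition (Nemytskii) operator of `g`. -/
noncomputable def superpose (g : T → E → F) (hg : IsSuperposable g) (u : T →ᵇ E) : T →ᵇ F :=
  BoundedContinuousFunction.ofNormedAddCommGroup (fun t => g t (u t))
    (hg.continuous.comp (continuous_id.prodMk u.continuous)) (hg.bounded ‖u‖).choose
    fun t => (hg.bounded ‖u‖).choose_spec t (u t) (u.norm_coe_le_norm t)

@[simp] theorem superpose_apply (g : T → E → F) (hg : IsSuperposable g) (u : T →ᵇ E) (t : T) :
    superpose g hg u t = g t (u t) := rfl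

theorem continuous_superpose (g : T → E → F) (hg : IsSuperposable g) :
    Continuous (superpose g hg) := by
  rw [Metric.continuous_iff]
  intro u ε hε
  obtain ⟨δ, hδ, h⟩ := hg.equicont (‖u‖ + 1) (ε / 2) (half_pos hε)
  refine ⟨min δ 1, lt_min hδ one_pos, fun u' hu' => ?_⟩
  rw [dist_eq_norm] at hu' ⊢
  have h1 : ‖u'‖ ≤ ‖u‖ + 1 := by
    have := norm_add_le (u' - u) u
    rw [sub_add_cancel] at this
    linarith [hu'.trans_le (min_le_right _ _)]
  refine lt_of_le_of_lt ?_ (half_lt_self hε)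
  rw [BoundedContinuousFunction.norm_le (half_pos hε).le]
  intro t
  refine h t (u' t) (u t) ((u'.norm_coe_le_norm t).trans h1)
    ((u.norm_coe_le_norm t).trans (by linarith)) ?_
  exact ((u' - u).norm_coe_le_norm t).trans_lt (hu'.trans_le (min_le_left _ _))

variable (T E F) in
/-- A family of bounded operators acts on bounded continuous functions pointwise. -/
noncomputable def pointwiseApply :
    (T →ᵇ (E →L[ℝ] F)) →L[ℝ] (T →ᵇ E) →L[ℝ] (T →ᵇ F) :=
  LinearMap.mkContinuous₂
    (LinearMap.mk₂ ℝ
      (fun (a : T →ᵇ (E →L[ℝ] F)) (h : T →ᵇ E) =>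
        BoundedContinuousFunction.ofNormedAddCommGroup (fun t => a t (h t))
          (a.continuous.clm_apply h.continuous) (‖a‖ * ‖h‖)
          fun t => ((a t).le_opNorm _).trans
            (mul_le_mul (a.norm_coe_le_norm t) (h.norm_coe_le_norm t) (norm_nonneg _)
              (norm_nonneg a)))
      (fun a b h => by ext t; simp) (fun c a h => by ext t; simp)
      (fun a h k => by ext t; simp) (fun c a h => by ext t; simp))
    1 fun a h => by
      rw [one_mul]
      refine (BoundedContinuousFunction.norm_le (mul_nonneg (norm_nonneg a) (norm_nonneg h))).2
        fun t => ((a t).le_opNorm _).trans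
          (mul_le_mul (a.norm_coe_le_norm t) (h.norm_coe_le_norm t) (norm_nonneg _)
            (norm_nonneg a))

@[simp] theorem pointwiseApply_apply (a : T →ᵇ (E →L[ℝ] F)) (h : T →ᵇ E) (t : T) :
    pointwiseApply T E F a h t = a t (h t) := rfl

theorem norm_pointwiseApply_le (a : T →ᵇ (E →L[ℝ] F)) : ‖pointwiseApply T E F a‖ ≤ ‖a‖ := by
  refine ContinuousLinearMap.opNorm_le_bound _ (norm_nonneg a) fun h => ?_
  rw [BoundedContinuousFunction.norm_le (mul_nonneg (norm_nonneg a) (norm_nonneg h))]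
  exact fun t => ((a t).le_opNorm _).trans
    (mul_le_mul (a.norm_coe_le_norm t) (h.norm_coe_le_norm t) (norm_nonneg _) (norm_nonneg a))

/-- The mean value inequality is applied at each t; equicontinuity of `g'` uniform in t makes the
error o(‖k‖) in the supremum norm. -/
theorem hasFDerivAt_superpose {g : T → E → F} {g' : T → E → E →L[ℝ] F} (hg : IsSuperposable g)
    (hg' : IsSuperposable g') (hd : ∀ t u, HasFDerivAt (g t) (g' t u) u) (u : T →ᵇ E) :
    HasFDerivAt (superpose g hg) (pointwiseApply T E F (superpose g' hg' u)) u := by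
  rw [hasFDerivAt_iff_isLittleO_nhds_zero, Asymptotics.isLittleO_iff]
  intro ε hε
  obtain ⟨δ, hδ, h⟩ := hg'.equicont (‖u‖ + 1) ε hε
  filter_upwards [Metric.ball_mem_nhds (0 : T →ᵇ E) (lt_min hδ one_pos)] with k hk
  rw [mem_ball_zero_iff] at hk
  rw [BoundedContinuousFunction.norm_le (by positivity)]
  intro t
  have hkt : ‖k t‖ < min δ 1 := (k.norm_coe_le_norm t).trans_lt hk
  have hut : ‖u t‖ ≤ ‖u‖ := u.norm_coe_le_norm t
  have key : ‖g t (u t + k t) - g t (u t) - g' t (u t) (u t + k t - u t)‖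
      ≤ ε * ‖u t + k t - u t‖ := by
    refine (convex_ball (u t) (min δ 1)).norm_image_sub_le_of_norm_hasFDerivWithin_le'
      (f' := g' t) (fun x _ => (hd t x).hasFDerivWithinAt) (fun x hx => ?_)
      (Metric.mem_ball_self (lt_min hδ one_pos)) (by simpa [dist_eq_norm] using hkt)
    rw [mem_ball_iff_norm] at hx
    refine h t x (u t) ?_ (by linarith) (hx.trans_le (min_le_left _ _))
    have := norm_add_le (x - u t) (u t)
    rw [sub_add_cancel] at this
    linarith [hx.trans_le (min_le_right _ _)]
  rw [add_sub_cancel_left] at key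
  change ‖g t (u t + k t) - g t (u t) - (g' t (u t)) (k t)‖ ≤ _
  exact key.trans (mul_le_mul_of_nonneg_left (k.norm_coe_le_norm t) hε.le)

theorem contDiff_one_superpose {g : T → E → F} {g' : T → E → E →L[ℝ] F} (hg : IsSuperposable g)
    (hg' : IsSuperposable g') (hd : ∀ t u, HasFDerivAt (g t) (g' t u) u) :
    ContDiff ℝ 1 (superpose g hg) := by
  rw [contDiff_one_iff_hasFDerivAt]
  exact ⟨_, (pointwiseApply T E F).continuous.comp (continuous_superpose g' hg'),
    hasFDerivAt_superpose hg hg' hd⟩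

/-- The derivative is the superposition operator of `g'` followed by a fixed bounded linear map, so
one order of smoothness reduces to the same question for `g'`. -/
theorem contDiff_two_superpose {g : T → E → F} {g' : T → E → E →L[ℝ] F}
    {g'' : T → E → E →L[ℝ] E →L[ℝ] F} (hg : IsSuperposable g) (hg' : IsSuperposable g')
    (hg'' : IsSuperposable g'') (hd : ∀ t u, HasFDerivAt (g t) (g' t u) u)
    (hd' : ∀ t u, HasFDerivAt (g' t) (g'' t u) u) :
    ContDiff ℝ 2 (superpose g hg) := by
  rw [show (2 : WithTop ℕ∞) = ((1 : ℕ) : WithTop ℕ∞) + 1 by norm_num,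
    contDiff_succ_iff_hasFDerivAt]
  refine ⟨fun u => pointwiseApply T E F (superpose g' hg' u), ?_,
    hasFDerivAt_superpose hg hg' hd⟩
  exact (pointwiseApply T E F).contDiff.comp
    (by simpa using contDiff_one_superpose hg' hg'' hd')

/-- A family whose derivative is superposable and which is bounded at `0` is superposable. -/
theorem IsSuperposable.of_hasFDerivAt {g : T → E → F} {g' : T → E → E →L[ℝ] F}
    (hg' : IsSuperposable g') (hd : ∀ t u, HasFDerivAt (g t) (g' t u) u)
    (hc : Continuous fun p : T × E => g p.1 p.2) (h0 : ∀ t, g t 0 = 0) : IsSuperposable g := by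
  have lip : ∀ ρ B : ℝ, (∀ t u, ‖u‖ ≤ ρ → ‖g' t u‖ ≤ B) → ∀ t u u', ‖u‖ ≤ ρ → ‖u'‖ ≤ ρ →
      ‖g t u - g t u'‖ ≤ B * ‖u - u'‖ := fun ρ B hB t u u' hu hu' =>
    (convex_closedBall (0 : E) ρ).norm_image_sub_le_of_norm_hasFDerivWithin_le
      (f' := g' t) (fun x _ => (hd t x).hasFDerivWithinAt)
      (fun x hx => hB t x (by simpa using hx)) (by simpa using hu') (by simpa using hu)
  refine ⟨hc, fun ρ => ?_, fun ρ ε hε => ?_⟩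
  · obtain ⟨B, hB⟩ := hg'.bounded ρ
    refine ⟨|B| * ρ, fun t u hu => ?_⟩
    have := lip ρ |B| (fun t u hu => (hB t u hu).trans (le_abs_self _)) t u 0 hu
      (by simpa using (norm_nonneg u).trans hu)
    rw [h0, sub_zero, sub_zero] at this
    exact this.trans (mul_le_mul_of_nonneg_left hu (abs_nonneg _))
  · obtain ⟨B, hB⟩ := hg'.bounded ρ
    refine ⟨ε / (|B| + 1), by positivity, fun t u u' hu hu' h => ?_⟩
    refine (lip ρ (|B| + 1) (fun t u hu => (hB t u hu).trans ?_) t u u' hu hu').trans ?_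
    · linarith [le_abs_self B]
    · rw [lt_div_iff₀ (by positivity)] at h
      linarith [mul_comm ‖u - u'‖ (|B| + 1)]

end Superposition

/-! ### The equation u = a + G(S u): existence, uniqueness, smooth dependence -/

section PerturbedIdentity

variable {X Y : Type*} [NormedAddCommGroup X] [NormedSpace ℝ X] [NormedAddCommGroup Y]
  [NormedSpace ℝ Y]

/-- A differentiable map whose derivative at `u` has norm at most `C * ‖u‖` on the unit ball is
Lipschitz with constant `C * ρ` on the ball of radius `ρ ≤ 1`. -/
theorem norm_sub_le_of_norm_fderiv_le_mul_norm {S : X → Y} (hS : Differentiable ℝ S) {C ρ : ℝ}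
    (hC : 0 ≤ C) (hSC : ∀ u, ‖u‖ ≤ 1 → ‖fderiv ℝ S u‖ ≤ C * ‖u‖) (hρ : ρ ≤ 1) {u u' : X}
    (hu : ‖u‖ ≤ ρ) (hu' : ‖u'‖ ≤ ρ) : ‖S u - S u'‖ ≤ C * ρ * ‖u - u'‖ :=
  (convex_closedBall (0 : X) ρ).norm_image_sub_le_of_norm_hasFDerivWithin_le
    (f' := fderiv ℝ S) (fun x _ => (hS x).hasFDerivAt.hasFDerivWithinAt)
    (fun x hx => by
      rw [mem_closedBall_zero_iff] at hx
      exact (hSC x (hx.trans hρ)).trans (mul_le_mul_of_nonneg_left hx hC))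
    (by simpa using hu') (by simpa using hu)

variable {S : X → X} {G : X →L[ℝ] X} {γ C R : ℝ}

theorem norm_clm_comp_sub_le (hS : Differentiable ℝ S) (hG : ‖G‖ ≤ γ) (hC : 0 ≤ C)
    (hSC : ∀ u, ‖u‖ ≤ 1 → ‖fderiv ℝ S u‖ ≤ C * ‖u‖) (hR1 : R < 1)
    {u u' : X} (hu : ‖u‖ ≤ R) (hu' : ‖u'‖ ≤ R) :
    ‖G (S u) - G (S u')‖ ≤ γ * C * R * ‖u - u'‖ := by
  rw [← map_sub]
  refine (G.le_opNorm _).trans ?_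
  have h1 := norm_sub_le_of_norm_fderiv_le_mul_norm hS hC hSC hR1.le hu hu'
  calc ‖G‖ * ‖S u - S u'‖ ≤ γ * (C * R * ‖u - u'‖) :=
        mul_le_mul hG h1 (norm_nonneg _) ((norm_nonneg _).trans hG)
    _ = γ * C * R * ‖u - u'‖ := by ring

/-- Two solutions of `u = a + G (S u)` in the ball of radius `R` depend on `a` in a Lipschitz
way. -/
theorem norm_sub_le_of_eq_add_clm_comp (hS : Differentiable ℝ S) (hG : ‖G‖ ≤ γ) (hC : 0 ≤ C)
    (hSC : ∀ u, ‖u‖ ≤ 1 → ‖fderiv ℝ S u‖ ≤ C * ‖u‖) (hR1 : R < 1)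
    (hγ : 2 * (γ * C * R) < 1) {u u' a a' : X} (hu : ‖u‖ ≤ R) (hu' : ‖u'‖ ≤ R)
    (h : u = a + G (S u)) (h' : u' = a' + G (S u')) : ‖u - u'‖ ≤ 2 * ‖a - a'‖ := by
  have h1 := norm_clm_comp_sub_le hS hG hC hSC hR1 hu hu'
  have h2 : u - u' = (a - a') + (G (S u) - G (S u')) := by
    conv_lhs => rw [h, h']
    abel
  have h3 := norm_add_le (a - a') (G (S u) - G (S u'))
  rw [← h2] at h3
  -- As γCR < 1/2, the nonlinear term is absorbed by half of the left-hand side.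
  nlinarith [norm_nonneg (u - u')]

/-- Banach's fixed point theorem on the closed R-ball. The contraction constant is γCR, and `S 0 =
0` turns the Lipschitz bound into ‖G(S u)‖ ≤ γCR², so the ball is mapped to itself. -/
theorem exists_eq_add_clm_comp [CompleteSpace X] (hS : Differentiable ℝ S) (hS0 : S 0 = 0)
    (hG : ‖G‖ ≤ γ) (hC : 0 ≤ C)
    (hSC : ∀ u, ‖u‖ ≤ 1 → ‖fderiv ℝ S u‖ ≤ C * ‖u‖) (hR : 0 ≤ R) (hR1 : R < 1)
    (hγ : 2 * (γ * C * R) < 1) {a : X} (ha : ‖a‖ + γ * C * R ^ 2 ≤ R) :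
    ∃ u, ‖u‖ ≤ R ∧ u = a + G (S u) := by
  have hlip : ∀ u u' : X, ‖u‖ ≤ R → ‖u'‖ ≤ R →
      ‖G (S u) - G (S u')‖ ≤ γ * C * R * ‖u - u'‖ := fun u u' hu hu' =>
    norm_clm_comp_sub_le hS hG hC hSC hR1 hu hu'
  have hγ0 : 0 ≤ γ * C * R :=
    mul_nonneg (mul_nonneg ((norm_nonneg _).trans hG) hC) hR
  have hmaps : MapsTo (fun u => a + G (S u)) (Metric.closedBall 0 R) (Metric.closedBall 0 R) := by
    intro u hu
    rw [mem_closedBall_zero_iff] at hu ⊢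
    have h1 := hlip u 0 hu (by simpa using hR)
    rw [hS0, map_zero, sub_zero, sub_zero] at h1
    have h2 := norm_add_le a (G (S u))
    nlinarith
  obtain ⟨κ, hκ⟩ : ∃ κ : NNReal, (κ : ℝ) = γ * C * R :=
    ⟨Real.toNNReal _, Real.coe_toNNReal _ hγ0⟩
  have hcontr : ContractingWith κ (hmaps.restrict _ _ _) := by
    refine ⟨by rw [← NNReal.coe_lt_coe, hκ, NNReal.coe_one]; linarith, ?_⟩
    refine LipschitzWith.of_dist_le_mul fun u u' => ?_
    rw [Subtype.dist_eq, Subtype.dist_eq, dist_eq_norm, dist_eq_norm, hκ]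
    have := hlip u u' (mem_closedBall_zero_iff.1 u.2) (mem_closedBall_zero_iff.1 u'.2)
    simpa using this
  obtain ⟨u, hu, hfix, -⟩ := hcontr.exists_fixedPoint' Metric.isClosed_closedBall.isComplete
    hmaps (x := (0 : X)) (by simpa using hR) (edist_ne_top _ _)
  exact ⟨u, by simpa using hu, hfix.eq.symm⟩

/-- If `S` is `C²`, then solutions `u y` of `u y = a y + G (S (u y))` in the ball of radius `R`
form a `C²` family. -/
theorem contDiffOn_of_eq_add_clm_comp [CompleteSpace X] (hS : ContDiff ℝ 2 S)
    (hG : ‖G‖ ≤ γ) (hC : 0 ≤ C)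
    (hSC : ∀ u, ‖u‖ ≤ 1 → ‖fderiv ℝ S u‖ ≤ C * ‖u‖) (hR1 : R < 1)
    (hγ : 2 * (γ * C * R) < 1) (a : Y →L[ℝ] X) {V : Set Y} (hV : IsOpen V) {u : Y → X}
    (hu : ∀ y ∈ V, ‖u y‖ ≤ R) (hfix : ∀ y ∈ V, u y = a y + G (S (u y))) :
    ContDiffOn ℝ 2 u V := by
  have hSd : Differentiable ℝ S := hS.differentiable (by norm_num)
  intro y₀ hy₀
  refine ContDiffAt.contDiffWithinAt ?_
  -- Continuity comes first: a local inverse of id - G ∘ S recovers `u y` only when `u y` is already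
  -- close to `u y₀`.
  have hcont : ContinuousAt u y₀ := by
    refine Metric.continuousAt_iff.2 fun ε hε => ?_
    have hev : ∀ᶠ y in 𝓝 y₀, y ∈ V ∧ 2 * ‖a y - a y₀‖ < ε := by
      refine Filter.Eventually.and (hV.mem_nhds hy₀) ?_
      have : Tendsto (fun y => 2 * ‖a y - a y₀‖) (𝓝 y₀) (𝓝 (2 * ‖a y₀ - a y₀‖)) :=
        (by fun_prop : Continuous fun y => 2 * ‖a y - a y₀‖).tendsto y₀
      exact this.eventually_lt_const (by simpa using hε)
    obtain ⟨δ, hδ, h⟩ := Metric.eventually_nhds_iff.1 hev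
    refine ⟨δ, hδ, fun y hy => ?_⟩
    rw [dist_eq_norm]
    exact (norm_sub_le_of_eq_add_clm_comp hSd hG hC hSC hR1 hγ (hu y (h hy).1) (hu y₀ hy₀)
      (hfix y (h hy).1) (hfix y₀ hy₀)).trans_lt (h hy).2
  set Ψ : X → X := fun w => w - G (S w) with hΨ
  have hΨ2 : ContDiff ℝ 2 Ψ := contDiff_id.sub (G.contDiff.comp hS)
  set B : X →L[ℝ] X := G.comp (fderiv ℝ S (u y₀)) with hB
  have hBnorm : ‖B‖ < 1 := by
    have h1 := hSC (u y₀) ((hu y₀ hy₀).trans hR1.le)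
    have h2 : ‖B‖ ≤ γ * (C * R) := (ContinuousLinearMap.opNorm_comp_le _ _).trans
      (mul_le_mul hG (h1.trans (mul_le_mul_of_nonneg_left (hu y₀ hy₀) hC)) (norm_nonneg _)
        ((norm_nonneg _).trans hG))
    have h3 : 0 ≤ ‖B‖ := norm_nonneg _
    nlinarith
  -- The derivative 1 - B of Ψ at `u y₀` is invertible by the Neumann series.
  set e : X ≃L[ℝ] X :=
    ContinuousLinearEquiv.unitsEquiv ℝ X (Units.oneSub B hBnorm) with he
  have hder : HasFDerivAt Ψ (e : X →L[ℝ] X) (u y₀) := by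
    have h1 : HasFDerivAt Ψ (ContinuousLinearMap.id ℝ X - B) (u y₀) :=
      (hasFDerivAt_id _).sub (G.hasFDerivAt.comp (u y₀) (hSd (u y₀)).hasFDerivAt)
    exact h1
  have hloc := hΨ2.contDiffAt.to_localInverse hder (by norm_num)
  have hΨu : ∀ y ∈ V, Ψ (u y) = a y := fun y hy => by
    rw [hΨ]
    exact sub_eq_iff_eq_add.2 (hfix y hy)
  rw [hΨu y₀ hy₀] at hloc
  refine (hloc.comp y₀ a.contDiff.contDiffAt).congr_of_eventuallyEq ?_
  have hleft := (hΨ2.contDiffAt.hasStrictFDerivAt' hder (by norm_num)).eventually_left_inverse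
  filter_upwards [hcont.eventually hleft, hV.mem_nhds hy₀] with y hy hyV
  rw [hΨu y hyV] at hy
  exact hy.symm

end PerturbedIdentity

/-! ### Linear differential equations on the whole line -/

section LinearODE

variable {F : Type*} [NormedAddCommGroup F] [NormedSpace ℝ F]

/-- Global solutions of a linear differential equation with bounded continuous coefficients. -/
theorem exists_hasDerivAt_clm_apply [CompleteSpace F] {A : ℝ → F →L[ℝ] F} (hA : Continuous A)
    {L : ℝ} (hL : ∀ t, ‖A t‖ ≤ L) (x₀ : F) :
    ∃ U : ℝ → F, U 0 = x₀ ∧ ∀ t, HasDerivAt U (A t (U t)) t := by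
  wlog hL0 : 0 < L generalizing L
  · exact this (L := |L| + 1) (fun t => (hL t).trans (by linarith [le_abs_self L])) (by positivity)
  -- Solutions are sought as W φ with φ bounded. The integral of W from 0 to t is at most W(t)/(2L)
  -- in absolute value, so in this weight the Volterra operator has norm at most L/(2L) = 1/2 on all
  -- of ℝ at once.
  set W : ℝ → ℝ := fun t => Real.exp (2 * L * t) + Real.exp (-(2 * L * t)) with hW
  have hWpos : ∀ t, 0 < W t := fun t => by positivity
  have hWcont : Continuous W := by fun_prop
  have hWint : ∀ t, |∫ s in (0 : ℝ)..t, W s| ≤ W t / (2 * L) := by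
    intro t
    have hd : ∀ s ∈ uIcc 0 t, HasDerivAt
        (fun s => (Real.exp (2 * L * s) - Real.exp (-(2 * L * s))) / (2 * L)) (W s) s := by
      intro s _
      have h1 : HasDerivAt (fun s => 2 * L * s) (2 * L) s := by
        simpa using (hasDerivAt_id s).const_mul (2 * L)
      have h2 := (h1.exp.sub h1.neg.exp).div_const (2 * L)
      refine h2.congr_deriv ?_
      simp only [hW, Pi.neg_apply]
      field_simp
      ring
    rw [intervalIntegral.integral_eq_sub_of_hasDerivAt hd (hWcont.intervalIntegrable _ _)]
    simp only [mul_zero, Real.exp_zero, neg_zero, sub_self, zero_div, sub_zero]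
    rw [abs_div, abs_of_pos (by positivity : (0 : ℝ) < 2 * L)]
    gcongr
    rw [abs_le, hW]
    constructor <;> linarith [Real.exp_pos (2 * L * t), Real.exp_pos (-(2 * L * t))]
  have hcont : ∀ φ : ℝ →ᵇ F, Continuous fun s => W s • A s (φ s) := fun φ =>
    hWcont.smul (hA.clm_apply φ.continuous)
  have hVcont : ∀ φ : ℝ →ᵇ F, Continuous fun t => ∫ s in (0 : ℝ)..t, W s • A s (φ s) := fun φ =>
    intervalIntegral.continuous_primitive (fun a b => (hcont φ).intervalIntegrable a b) 0
  have hVbound : ∀ (φ : ℝ →ᵇ F) t,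
      ‖(W t)⁻¹ • ∫ s in (0 : ℝ)..t, W s • A s (φ s)‖ ≤ 1 / 2 * ‖φ‖ := by
    intro φ t
    have h1 : ‖∫ s in (0 : ℝ)..t, W s • A s (φ s)‖ ≤ |∫ s in (0 : ℝ)..t, L * ‖φ‖ * W s| := by
      refine intervalIntegral.norm_integral_le_abs_of_norm_le (Eventually.of_forall fun s => ?_)
        ((continuous_const.mul hWcont).intervalIntegrable _ _)
      rw [norm_smul, Real.norm_of_nonneg (hWpos s).le, mul_comm]
      refine mul_le_mul_of_nonneg_right ?_ (hWpos s).le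
      exact ((A s).le_opNorm _).trans
        (mul_le_mul (hL s) (φ.norm_coe_le_norm s) (norm_nonneg _) hL0.le)
    rw [intervalIntegral.integral_const_mul, abs_mul, abs_of_nonneg (by positivity)] at h1
    rw [norm_smul, norm_inv, Real.norm_of_nonneg (hWpos t).le, inv_mul_le_iff₀ (hWpos t)]
    refine h1.trans ((mul_le_mul_of_nonneg_left (hWint t) (by positivity)).trans_eq ?_)
    field_simp
  have hWinv : Continuous fun t => (W t)⁻¹ := hWcont.inv₀ fun t => (hWpos t).ne'
  let T : (ℝ →ᵇ F) →L[ℝ] (ℝ →ᵇ F) := LinearMap.mkContinuous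
    { toFun := fun φ => BoundedContinuousFunction.ofNormedAddCommGroup
        (fun t => (W t)⁻¹ • ∫ s in (0 : ℝ)..t, W s • A s (φ s))
        (hWinv.smul (hVcont φ)) _ (hVbound φ)
      map_add' := fun φ ψ => by
        ext t
        simp only [BoundedContinuousFunction.coe_ofNormedAddCommGroup,
          BoundedContinuousFunction.coe_add, Pi.add_apply, map_add, smul_add]
        rw [intervalIntegral.integral_add ((hcont φ).intervalIntegrable _ _)
          ((hcont ψ).intervalIntegrable _ _), smul_add]
      map_smul' := fun c φ => by
        ext t
        simp only [BoundedContinuousFunction.coe_ofNormedAddCommGroup,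
          BoundedContinuousFunction.coe_smul, map_smul, RingHom.id_apply]
        simp only [smul_comm _ c, intervalIntegral.integral_smul] } (1 / 2)
    fun φ => (BoundedContinuousFunction.norm_le (by positivity)).2 (hVbound φ)
  have hT : ‖T‖ < 1 := (LinearMap.mkContinuous_norm_le _ (by norm_num) _).trans_lt (by norm_num)
  let b : ℝ →ᵇ F := BoundedContinuousFunction.ofNormedAddCommGroup (fun t => (W t)⁻¹ • x₀)
    (hWinv.smul continuous_const) ‖x₀‖ fun t => by
      rw [norm_smul, norm_inv, Real.norm_of_nonneg (hWpos t).le, inv_mul_le_iff₀ (hWpos t)]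
      refine le_mul_of_one_le_left (norm_nonneg _) ?_
      rcases le_total 0 t with h | h
      · exact (Real.one_le_exp (by positivity)).trans (le_add_of_nonneg_right (Real.exp_pos _).le)
      · refine (Real.one_le_exp ?_).trans (le_add_of_nonneg_left (Real.exp_pos _).le)
        nlinarith
  obtain ⟨φ, hφ⟩ : ∃ φ : ℝ →ᵇ F, φ = b + T φ := by
    set φ := ((Units.oneSub T hT)⁻¹ : ((ℝ →ᵇ F) →L[ℝ] (ℝ →ᵇ F))ˣ).1 b with hφ
    refine ⟨φ, ?_⟩
    have h1 : ((Units.oneSub T hT : (ℝ →ᵇ F) →L[ℝ] (ℝ →ᵇ F)) *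
      ((Units.oneSub T hT)⁻¹ : ((ℝ →ᵇ F) →L[ℝ] (ℝ →ᵇ F))ˣ)) b = b := by
      rw [Units.mul_inv]; rfl
    have h2 : φ - T φ = b := by
      rw [hφ]
      exact h1
    rw [← h2, sub_add_cancel]
  have hφt : ∀ t, W t • φ t = x₀ + ∫ s in (0 : ℝ)..t, A s (W s • φ s) := by
    intro t
    have h1 : φ t = (W t)⁻¹ • x₀ + (W t)⁻¹ • ∫ s in (0 : ℝ)..t, W s • A s (φ s) :=
      congrArg (fun ψ : ℝ →ᵇ F => ψ t) hφ
    rw [h1, smul_add, smul_inv_smul₀ (hWpos t).ne', smul_inv_smul₀ (hWpos t).ne']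
    simp only [map_smul]
  refine ⟨fun t => W t • φ t, by simpa using hφt 0, fun t => ?_⟩
  rw [funext hφt]
  have hc : Continuous fun s => A s (W s • φ s) := hA.clm_apply (hWcont.smul φ.continuous)
  have := (intervalIntegral.integral_hasDerivAt_right (hc.intervalIntegrable 0 t)
    (hc.stronglyMeasurableAtFilter _ _) hc.continuousAt).const_add x₀
  exact this.congr_deriv (congrArg (A t) (hφt t))

/-- The fundamental solution of a linear differential equation in a finite-dimensional space and
its inverse. -/
theorem exists_fundamental_solution [FiniteDimensional ℝ F] {A : ℝ → F →L[ℝ] F}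
    (hA : Continuous A) {L : ℝ} (hL : ∀ t, ‖A t‖ ≤ L) :
    ∃ U Z : ℝ → F →L[ℝ] F, U 0 = 1 ∧ (∀ t, HasDerivAt U (A t * U t) t) ∧
      (∀ t, HasDerivAt Z (-(Z t * A t)) t) ∧ (∀ t, Z t * U t = 1) ∧ ∀ t, U t * Z t = 1 := by
  have : CompleteSpace F := FiniteDimensional.complete ℝ F
  obtain ⟨U, hU0, hU⟩ := exists_hasDerivAt_clm_apply (F := F →L[ℝ] F)
    (A := fun t => ContinuousLinearMap.mul ℝ (F →L[ℝ] F) (A t)) (L := L) (by fun_prop)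
    (fun t => (ContinuousLinearMap.opNorm_mul_apply_le _ _ _).trans (hL t)) 1
  obtain ⟨Z, hZ0, hZ⟩ := exists_hasDerivAt_clm_apply (F := F →L[ℝ] F)
    (A := fun t => -(ContinuousLinearMap.mul ℝ (F →L[ℝ] F)).flip (A t)) (L := L) (by fun_prop)
    (fun t => by
      rw [norm_neg]
      refine ContinuousLinearMap.opNorm_le_bound _ ((norm_nonneg _).trans (hL t)) fun B => ?_
      rw [ContinuousLinearMap.flip_apply, ContinuousLinearMap.mul_apply', mul_comm]
      exact (norm_mul_le _ _).trans (mul_le_mul_of_nonneg_left (hL t) (norm_nonneg _))) 1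
  have hU' : ∀ t, HasDerivAt U (A t * U t) t := hU
  have hZ' : ∀ t, HasDerivAt Z (-(Z t * A t)) t := hZ
  have hZU : ∀ t, Z t * U t = 1 := by
    have hd : ∀ t, HasDerivAt (fun t => Z t * U t) 0 t := fun t => by
      refine ((hZ' t).mul (hU' t)).congr_deriv ?_
      rw [neg_mul, mul_assoc, neg_add_cancel]
    intro t
    have := is_const_of_deriv_eq_zero (fun t => (hd t).differentiableAt) (fun t => (hd t).deriv)
      t 0
    simpa [hU0, hZ0] using this
  refine ⟨U, Z, hU0, hU', hZ', hZU, fun t => ?_⟩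
  -- In finite dimension a left inverse is also a right inverse.
  have h1 : (Z t : F →ₗ[ℝ] F) * (U t : F →ₗ[ℝ] F) = 1 := by
    ext x
    exact congrArg (fun B : F →L[ℝ] F => B x) (hZU t)
  have h2 := mul_eq_one_comm.1 h1
  ext x
  exact congrArg (fun B : F →ₗ[ℝ] F => B x) h2

end LinearODE

/-! ### The variational equation and the derivative of the flow -/

section FlowDerivative

variable {E : Type*} [NormedAddCommGroup E] [InnerProductSpace ℝ E] [FiniteDimensional ℝ E]
  {v : E → E} {χ : Flow ℝ E}

omit [FiniteDimensional ℝ E] in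
theorem GeneratesFlow.continuous_orbit (hχ : GeneratesFlow v χ) (x : E) :
    Continuous fun t => χ t x :=
  continuous_iff_continuousAt.2 fun t => (hχ x t).continuousAt

theorem exists_norm_fderiv_le_of_norm_le (hv : ContDiff ℝ 1 v) (ρ : ℝ) :
    ∃ L : NNReal, 0 < L ∧ ∀ x, ‖x‖ ≤ ρ → ‖fderiv ℝ v x‖ ≤ L := by
  have hc : Continuous fun x => ‖fderiv ℝ v x‖ := (hv.continuous_fderiv (by norm_num)).norm
  obtain ⟨L, hL⟩ := ((isCompact_closedBall (0 : E) ρ).image hc).bddAbove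
  refine ⟨Real.toNNReal (max L 1), by simp, fun x hx => ?_⟩
  rw [Real.coe_toNNReal _ (le_max_of_le_right zero_le_one)]
  exact (hL (mem_image_of_mem _ (by simpa using hx))).trans (le_max_left _ _)

omit [FiniteDimensional ℝ E] in
theorem lipschitzOnWith_closedBall_of_norm_fderiv_le (hv : ContDiff ℝ 1 v) {ρ : ℝ} {L : NNReal}
    (hL : ∀ x, ‖x‖ ≤ ρ → ‖fderiv ℝ v x‖ ≤ L) : LipschitzOnWith L v (Metric.closedBall 0 ρ) :=
  (convex_closedBall (0 : E) ρ).lipschitzOnWith_of_nnnorm_fderiv_le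
    (fun x _ => (hv.differentiable (by norm_num)) x)
    fun x hx => hL x (by simpa using hx)

/-- Forward solutions of `x' = v x` are orbits of the flow. -/
theorem GeneratesFlow.eq_of_hasDerivAt (hχ : GeneratesFlow v χ) (hv : ContDiff ℝ 1 v) {x : ℝ → E}
    (hx : ∀ t, 0 ≤ t → HasDerivAt x (v (x t)) t) {t : ℝ} (ht : 0 ≤ t) : x t = χ t (x 0) := by
  have hxc : ContinuousOn x (Icc 0 t) := fun s hs => (hx s hs.1).continuousAt.continuousWithinAt
  have hyc : ContinuousOn (fun s => χ s (x 0)) (Icc 0 t) := (hχ.continuous_orbit _).continuousOn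
  -- v is only locally Lipschitz, so uniqueness is applied in a ball containing both compact
  -- trajectory segments.
  obtain ⟨B₁, hB₁⟩ := (isCompact_Icc.image_of_continuousOn hxc).isBounded.subset_closedBall 0
  obtain ⟨B₂, hB₂⟩ := (isCompact_Icc.image_of_continuousOn hyc).isBounded.subset_closedBall 0
  obtain ⟨L, -, hL⟩ := exists_norm_fderiv_le_of_norm_le hv (max B₁ B₂)
  refine ODE_solution_unique_of_mem_Icc_right (v := fun _ => v)
    (s := fun _ => Metric.closedBall 0 (max B₁ B₂))
    (fun _ _ => lipschitzOnWith_closedBall_of_norm_fderiv_le hv hL) hxc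
    (fun s hs => (hx s hs.1).hasDerivWithinAt)
    (fun s hs => Metric.closedBall_subset_closedBall (le_max_left _ _)
      (hB₁ (mem_image_of_mem _ (Ico_subset_Icc_self hs))))
    hyc (fun s _ => (hχ (x 0) s).hasDerivWithinAt)
    (fun s hs => Metric.closedBall_subset_closedBall (le_max_right _ _)
      (hB₂ (mem_image_of_mem _ (Ico_subset_Icc_self hs))))
    (by simp [χ.map_zero_apply]) ⟨ht, le_rfl⟩

/-- Along a bounded orbit, the fundamental solution of the variational equation is the derivative
of the flow. -/
theorem GeneratesFlow.hasFDerivAt_of_fundamental_solution (hχ : GeneratesFlow v χ)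
    (hv : ContDiff ℝ 1 v) {ξ : E} {B : ℝ} (hB : ∀ t, ‖χ t ξ‖ ≤ B) {U : ℝ → E →L[ℝ] E}
    (hU0 : U 0 = 1) (hU : ∀ t, HasDerivAt U (fderiv ℝ v (χ t ξ) * U t) t) {t : ℝ} (ht : 0 ≤ t) :
    HasFDerivAt (χ t) (U t) ξ := by
  obtain ⟨L, hL0, hL⟩ := exists_norm_fderiv_le_of_norm_le hv (B + 1)
  have hLip := lipschitzOnWith_closedBall_of_norm_fderiv_le hv hL
  have hv' : Continuous (fderiv ℝ v) := hv.continuous_fderiv (by norm_num)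
  have huc : UniformContinuousOn (fderiv ℝ v) (Metric.closedBall 0 (B + 1)) :=
    (isCompact_closedBall _ _).uniformContinuousOn_of_continuous hv'.continuousOn
  have hgron : ∀ e : ℝ, gronwallBound 0 L e t = e * ((Real.exp (L * t) - 1) / L) := fun e => by
    rw [gronwallBound_of_K_ne_0 (by exact_mod_cast hL0.ne')]
    ring
  rw [hasFDerivAt_iff_isLittleO_nhds_zero, Asymptotics.isLittleO_iff]
  intro ε' hε'
  -- The first factor bounds the separation of orbits over [0, t] relative to ‖k‖; the second is the
  -- Gronwall factor for a constant defect.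
  set κ : ℝ := Real.exp (L * t) * ((Real.exp (L * t) - 1) / L) with hκ
  have hκ0 : 0 ≤ κ := by
    have : 1 ≤ Real.exp (L * t) := Real.one_le_exp (by positivity)
    have : 0 ≤ Real.exp (L * t) - 1 := by linarith
    positivity
  set ε : ℝ := ε' / (κ + 1) with hεdef
  have hε : 0 < ε := by positivity
  obtain ⟨δ, hδ, hδ'⟩ := Metric.uniformContinuousOn_iff.1 huc ε hε
  have hnear : ∀ᶠ k in 𝓝 (0 : E), ∀ s ∈ Icc 0 t, ‖χ s (ξ + k) - χ s ξ‖ < min δ 1 := by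
    refine isCompact_Icc.eventually_forall_of_forall_eventually fun s _ => ?_
    have hc : Continuous fun z : E × ℝ => ‖χ z.2 (ξ + z.1) - χ z.2 ξ‖ := by fun_prop
    refine (hc.tendsto ((0 : E), s)).eventually_lt_const ?_
    simp [hδ]
  filter_upwards [hnear] with k hk
  have hball : ∀ s ∈ Icc 0 t, χ s (ξ + k) ∈ Metric.closedBall (0 : E) (B + 1) := fun s hs => by
    rw [mem_closedBall_zero_iff]
    have h1 := norm_add_le (χ s (ξ + k) - χ s ξ) (χ s ξ)
    rw [sub_add_cancel] at h1
    linarith [hB s, (hk s hs).trans_le (min_le_right _ _)]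
  have hball' : ∀ s, χ s ξ ∈ Metric.closedBall (0 : E) (B + 1) := fun s => by
    rw [mem_closedBall_zero_iff]
    linarith [hB s]
  have hyc : Continuous fun s => χ s (ξ + k) - χ s ξ :=
    (hχ.continuous_orbit _).sub (hχ.continuous_orbit _)
  have hy : ∀ s ∈ Icc 0 t, ‖χ s (ξ + k) - χ s ξ‖ ≤ ‖k‖ * Real.exp (L * t) := fun s hs => by
    rw [← dist_eq_norm]
    have h1 := dist_le_of_trajectories_ODE_of_mem (v := fun _ => v)
      (s := fun _ => Metric.closedBall 0 (B + 1)) (fun _ _ => hLip)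
      (hχ.continuous_orbit (ξ + k)).continuousOn (fun s _ => (hχ (ξ + k) s).hasDerivWithinAt)
      (fun s hs => hball s (Ico_subset_Icc_self hs)) (hχ.continuous_orbit ξ).continuousOn
      (fun s _ => (hχ ξ s).hasDerivWithinAt) (fun s _ => hball' s) (δ := ‖k‖)
      (by simp [χ.map_zero_apply]) s hs
    refine h1.trans ?_
    rw [sub_zero]
    gcongr
    exact hs.2
  have happrox : ∀ s ∈ Icc 0 t, ‖v (χ s (ξ + k)) - v (χ s ξ) -
      fderiv ℝ v (χ s ξ) (χ s (ξ + k) - χ s ξ)‖ ≤ ε * (‖k‖ * Real.exp (L * t)) := by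
    intro s hs
    refine le_trans ?_ (mul_le_mul_of_nonneg_left (hy s hs) hε.le)
    refine (convex_ball (χ s ξ) (min δ 1)).norm_image_sub_le_of_norm_hasFDerivWithin_le'
      (f' := fderiv ℝ v)
      (fun x _ => ((hv.differentiable (by norm_num)) x).hasFDerivAt.hasFDerivWithinAt)
      (fun x hx => ?_) (Metric.mem_ball_self (lt_min hδ one_pos))
      (by simpa [dist_eq_norm] using hk s hs)
    rw [Metric.mem_ball] at hx
    rw [← dist_eq_norm]
    refine (hδ' x ?_ _ (hball' s) (hx.trans_le (min_le_left _ _))).le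
    rw [mem_closedBall_zero_iff]
    have h1 := norm_add_le (x - χ s ξ) (χ s ξ)
    rw [sub_add_cancel, ← dist_eq_norm] at h1
    linarith [hB s, hx.trans_le (min_le_right _ _)]
  have hUc : Continuous U := continuous_iff_continuousAt.2 fun s => (hU s).continuousAt
  -- The difference of the two orbits solves the variational equation up to the defect in `happrox`,
  -- and `U s k` solves it exactly with the same initial value.
  have hfinal := dist_le_of_approx_trajectories_ODE (K := L)
    (v := fun s x => fderiv ℝ v (χ s ξ) x) (f := fun s => χ s (ξ + k) - χ s ξ)
    (g := fun s => U s k) (a := 0) (b := t) (δ := 0) (εf := ε * (‖k‖ * Real.exp (L * t)))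
    (εg := 0) (f' := fun s => v (χ s (ξ + k)) - v (χ s ξ))
    (g' := fun s => fderiv ℝ v (χ s ξ) (U s k))
    (fun s => ((fderiv ℝ v (χ s ξ)).lipschitz).weaken (hL _ (by linarith [hB s])))
    hyc.continuousOn (fun s _ => ((hχ (ξ + k) s).sub (hχ ξ s)).hasDerivWithinAt)
    (fun s hs => by rw [dist_eq_norm]; exact happrox s (Ico_subset_Icc_self hs))
    (hUc.clm_apply continuous_const).continuousOn
    (fun s _ => by
      have := (hU s).clm_apply (hasDerivAt_const s k)
      simpa using this.hasDerivWithinAt)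
    (fun s _ => by simp) (by simp [χ.map_zero_apply, hU0]) t ⟨ht, le_rfl⟩
  rw [dist_eq_norm, sub_zero, add_zero, hgron] at hfinal
  refine hfinal.trans ?_
  calc ε * (‖k‖ * Real.exp (L * t)) * ((Real.exp (L * t) - 1) / L) = ε * κ * ‖k‖ := by
        rw [hκ]; ring
    _ ≤ ε' * ‖k‖ := by
        refine mul_le_mul_of_nonneg_right ?_ (norm_nonneg _)
        rw [hεdef, div_mul_eq_mul_div, div_le_iff₀ (by positivity)]
        nlinarith

/-- Along a bounded orbit, the fundamental solution of the variational equation exists, and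
together with its inverse it gives the derivatives of the flow and of the backward flow. -/
theorem GeneratesFlow.exists_fundamental_solution (hχ : GeneratesFlow v χ)
    (hv : ContDiff ℝ 1 v) {ξ : E} {B : ℝ} (hB : ∀ t, ‖χ t ξ‖ ≤ B) :
    ∃ U Z : ℝ → E →L[ℝ] E, U 0 = 1 ∧ (∀ t, HasDerivAt U (fderiv ℝ v (χ t ξ) * U t) t) ∧
      (∀ t, HasDerivAt Z (-(Z t * fderiv ℝ v (χ t ξ))) t) ∧ (∀ t, Z t * U t = 1) ∧
      (∀ t, U t * Z t = 1) ∧ (∀ t, 0 ≤ t → HasFDerivAt (χ t) (U t) ξ) ∧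
      ∀ t, 0 ≤ t → HasFDerivAt (χ (-t)) (Z t) (χ t ξ) := by
  obtain ⟨L, -, hL⟩ := exists_norm_fderiv_le_of_norm_le hv B
  obtain ⟨U, Z, hU0, hU, hZ, hZU, hUZ⟩ := _root_.exists_fundamental_solution
    (A := fun t => fderiv ℝ v (χ t ξ))
    ((hv.continuous_fderiv (by norm_num)).comp (hχ.continuous_orbit ξ))
    fun t => hL _ (hB t)
  have hd : ∀ t, 0 ≤ t → HasFDerivAt (χ t) (U t) ξ := fun t ht =>
    hχ.hasFDerivAt_of_fundamental_solution hv hB hU0 hU ht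
  refine ⟨U, Z, hU0, hU, hZ, hZU, hUZ, hd, fun t ht => ?_⟩
  have hback : χ (-t) (χ t ξ) = ξ := by
    rw [← χ.map_add, neg_add_cancel, χ.map_zero_apply]
  let e : E ≃L[ℝ] E := ContinuousLinearEquiv.equivOfInverse (U t) (Z t)
    (fun x => congrArg (fun B : E →L[ℝ] E => B x) (hZU t))
    (fun x => congrArg (fun B : E →L[ℝ] E => B x) (hUZ t))
  -- χ^{-t} is a continuous inverse of χ^t, whose derivative at ξ is invertible; negative times need
  -- no separate Gronwall argument.
  refine HasFDerivAt.of_local_left_inverse (f' := e) (f := χ t)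
    (χ.continuous_toFun (-t)).continuousAt ?_ (Eventually.of_forall fun y => ?_)
  · rw [hback]
    exact hd t ht
  · rw [← χ.map_add, add_neg_cancel, χ.map_zero_apply]

end FlowDerivative

/-! ### Exponential splittings and the Green operator -/

section GreenOperator

open MeasureTheory

variable {E : Type*} [NormedAddCommGroup E] [NormedSpace ℝ E]

/-- A linear evolution `U` with inverse `Z` is split by the projection `P` into a part decaying
at rate `α` and a part which is the sum of a part growing at rate `α` and of a bounded part. -/
structure IsExponentialSplitting (U Z : ℝ → E →L[ℝ] E) (P : E →L[ℝ] E) (K α : ℝ) : Prop where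
  continuous_evolution : Continuous U
  continuous_inverse : Continuous Z
  evolution_zero : U 0 = 1
  evolution_mul_inverse : ∀ t, U t * Z t = 1
  inverse_mul_evolution : ∀ t, Z t * U t = 1
  proj_mul_proj : P * P = P
  rate_pos : 0 < α
  norm_stable_le : ∀ s t, 0 ≤ s → s ≤ t → ‖U t * P * Z s‖ ≤ K * Real.exp (-α * (t - s))
  norm_central_le : ∀ s t, 0 ≤ t → t ≤ s →
    ‖U t * (1 - P) * Z s‖ ≤ K * (Real.exp (α * (t - s)) + 1)

/-- The inhomogeneity `e^{-2αs} f(s)` pulled back to time zero by the inverse evolution `Z`. -/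
noncomputable def pullback (Z : ℝ → E →L[ℝ] E) (α : ℝ) (f : ℝ →ᵇ E) (s : ℝ) : E :=
  Real.exp (-2 * α * s) • Z s (f s)

/-- The solution, pulled back to time zero, of the inhomogeneous equation with right-hand side
`e^{-2αs} f(s)` that decays at infinity and has no `P`-component at time zero. -/
noncomputable def greenPullback (Z : ℝ → E →L[ℝ] E) (P : E →L[ℝ] E) (α : ℝ) (f : ℝ →ᵇ E)
    (t : ℝ) : E :=
  (∫ s in (0 : ℝ)..t, pullback Z α f s) - ∫ s in Ioi (0 : ℝ), (1 - P) (pullback Z α f s)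

namespace IsExponentialSplitting

variable {U Z : ℝ → E →L[ℝ] E} {P : E →L[ℝ] E} {K α : ℝ}

theorem inverse_zero (h : IsExponentialSplitting U Z P K α) : Z 0 = 1 := by
  simpa [h.evolution_zero] using h.evolution_mul_inverse 0

theorem const_nonneg (h : IsExponentialSplitting U Z P K α) : 0 ≤ K := by
  simpa using (norm_nonneg _).trans (h.norm_stable_le 0 0 le_rfl le_rfl)

theorem evolution_apply_inverse (h : IsExponentialSplitting U Z P K α) (t : ℝ) (x : E) :
    U t (Z t x) = x :=
  congrArg (fun B : E →L[ℝ] E => B x) (h.evolution_mul_inverse t)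

theorem proj_apply_proj (h : IsExponentialSplitting U Z P K α) (x : E) : P (P x) = P x :=
  congrArg (fun B : E →L[ℝ] E => B x) h.proj_mul_proj

theorem continuous_pullback (h : IsExponentialSplitting U Z P K α) (f : ℝ →ᵇ E) :
    Continuous (pullback Z α f) :=
  (by fun_prop : Continuous fun s => Real.exp (-2 * α * s)).smul
    (h.continuous_inverse.clm_apply f.continuous)

theorem norm_evolution_central_pullback_le (h : IsExponentialSplitting U Z P K α) (f : ℝ →ᵇ E)
    {s t : ℝ} (ht : 0 ≤ t) (hts : t ≤ s) :
    ‖U t ((1 - P) (pullback Z α f s))‖ ≤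
      K * ‖f‖ * (Real.exp (α * t) * Real.exp (-3 * α * s) + Real.exp (-2 * α * s)) := by
  have h1 : U t ((1 - P) (pullback Z α f s)) =
      Real.exp (-2 * α * s) • (U t * (1 - P) * Z s) (f s) := by
    simp only [pullback, map_smul]
    rfl
  rw [h1, norm_smul, Real.norm_of_nonneg (Real.exp_pos _).le]
  have h2 : ‖(U t * (1 - P) * Z s) (f s)‖ ≤ K * (Real.exp (α * (t - s)) + 1) * ‖f‖ :=
    ((U t * (1 - P) * Z s).le_opNorm _).trans
      (mul_le_mul (h.norm_central_le s t ht hts) (f.norm_coe_le_norm s) (norm_nonneg _)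
        ((norm_nonneg _).trans (h.norm_central_le s t ht hts)))
  refine (mul_le_mul_of_nonneg_left h2 (Real.exp_pos _).le).trans_eq ?_
  have h3 : Real.exp (α * t) * Real.exp (-3 * α * s) =
      Real.exp (-2 * α * s) * Real.exp (α * (t - s)) := by
    rw [← Real.exp_add, ← Real.exp_add]
    ring_nf
  rw [h3]
  ring

theorem norm_evolution_stable_pullback_le (h : IsExponentialSplitting U Z P K α) (f : ℝ →ᵇ E)
    {s t : ℝ} (hs : 0 ≤ s) (hst : s ≤ t) :
    ‖U t (P (pullback Z α f s))‖ ≤ K * ‖f‖ * (Real.exp (-α * t) * Real.exp (-α * s)) := by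
  have h1 : U t (P (pullback Z α f s)) = Real.exp (-2 * α * s) • (U t * P * Z s) (f s) := by
    simp only [pullback, map_smul]
    rfl
  rw [h1, norm_smul, Real.norm_of_nonneg (Real.exp_pos _).le]
  have h2 : ‖(U t * P * Z s) (f s)‖ ≤ K * Real.exp (-α * (t - s)) * ‖f‖ :=
    ((U t * P * Z s).le_opNorm _).trans
      (mul_le_mul (h.norm_stable_le s t hs hst) (f.norm_coe_le_norm s) (norm_nonneg _)
        ((norm_nonneg _).trans (h.norm_stable_le s t hs hst)))
  refine (mul_le_mul_of_nonneg_left h2 (Real.exp_pos _).le).trans_eq ?_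
  have h3 : Real.exp (-α * t) * Real.exp (-α * s) =
      Real.exp (-2 * α * s) * Real.exp (-α * (t - s)) := by
    rw [← Real.exp_add, ← Real.exp_add]
    ring_nf
  rw [h3]
  ring

/-- The central kernel need not decay, because of its neutral part; the weight e^{-2αs} alone gives
integrability. -/
theorem integrableOn_central_pullback (h : IsExponentialSplitting U Z P K α) (f : ℝ →ᵇ E)
    {t : ℝ} (ht : 0 ≤ t) : IntegrableOn (fun s => (1 - P) (pullback Z α f s)) (Ioi t) := by
  have hα := h.rate_pos
  have h3 : IntegrableOn (fun s => K * ‖f‖ * (Real.exp (-3 * α * s) + Real.exp (-2 * α * s)))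
      (Ioi t) := ((integrableOn_exp_mul_Ioi (by linarith) t).add
        (integrableOn_exp_mul_Ioi (by linarith) t)).const_mul _
  refine Integrable.mono' h3
    ((1 - P).continuous.comp (h.continuous_pullback f)).aestronglyMeasurable ?_
  refine (ae_restrict_iff' measurableSet_Ioi).2 (Eventually.of_forall fun s hs => ?_)
  have := h.norm_evolution_central_pullback_le f le_rfl (ht.trans (mem_Ioi.1 hs).le)
  simpa [h.evolution_zero] using this

theorem hasDerivAt_greenPullback [CompleteSpace E] (h : IsExponentialSplitting U Z P K α)
    (f : ℝ →ᵇ E) (t : ℝ) : HasDerivAt (greenPullback Z P α f) (pullback Z α f t) t := by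
  have hc := h.continuous_pullback f
  exact (intervalIntegral.integral_hasDerivAt_right (hc.intervalIntegrable 0 t)
    (hc.stronglyMeasurableAtFilter _ _) hc.continuousAt).sub_const _

theorem greenPullback_zero (Z : ℝ → E →L[ℝ] E) (P : E →L[ℝ] E) (α : ℝ) (f : ℝ →ᵇ E) :
    greenPullback Z P α f 0 = -∫ s in Ioi (0 : ℝ), (1 - P) (pullback Z α f s) := by
  simp [greenPullback]

theorem proj_greenPullback_zero [CompleteSpace E] (h : IsExponentialSplitting U Z P K α)
    (f : ℝ →ᵇ E) : P (greenPullback Z P α f 0) = 0 := by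
  rw [greenPullback_zero, map_neg, ← P.integral_comp_comm (h.integrableOn_central_pullback f le_rfl)]
  simp [h.proj_apply_proj]

/-- The defining formula is the one that is easily differentiated. This form pairs each component
with the range of s on which its kernel is controlled: s ≤ t for P, s ≥ t for 1 - P. -/
theorem greenPullback_eq [CompleteSpace E] (h : IsExponentialSplitting U Z P K α) (f : ℝ →ᵇ E)
    {t : ℝ} (ht : 0 ≤ t) :
    greenPullback Z P α f t = (∫ s in (0 : ℝ)..t, P (pullback Z α f s)) -
      ∫ s in Ioi t, (1 - P) (pullback Z α f s) := by
  have hc := h.continuous_pullback f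
  have hQc : Continuous fun s => (1 - P) (pullback Z α f s) := (1 - P).continuous.comp hc
  rw [greenPullback, ← intervalIntegral.integral_interval_add_Ioi
    (h.integrableOn_central_pullback f le_rfl) (h.integrableOn_central_pullback f ht),
    sub_add_eq_sub_sub, ← intervalIntegral.integral_sub (hc.intervalIntegrable _ _)
      (hQc.intervalIntegrable _ _)]
  simp

/-- The constant is 11/6 = 1 + 1/3 + 1/2. The stable integral gives e^{-αt}/α, which the weight
e^{αt} turns into 1/α; the unstable and neutral ones give e^{-2αt}/(3α) and e^{-2αt}/(2α), which
stay bounded under the weight. -/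
theorem norm_exp_smul_evolution_greenPullback_le [CompleteSpace E]
    (h : IsExponentialSplitting U Z P K α) (f : ℝ →ᵇ E) {t : ℝ} (ht : 0 ≤ t) :
    ‖Real.exp (α * t) • U t (greenPullback Z P α f t)‖ ≤ 11 / (6 * α) * K * ‖f‖ := by
  have hα := h.rate_pos
  have hc := h.continuous_pullback f
  have hPc : Continuous fun s => P (pullback Z α f s) := P.continuous.comp hc
  have hK : 0 ≤ K * ‖f‖ := mul_nonneg h.const_nonneg (norm_nonneg _)
  rw [h.greenPullback_eq f ht, map_sub, smul_sub]
  have h1 : ‖U t (∫ s in (0 : ℝ)..t, P (pullback Z α f s))‖ ≤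
      K * ‖f‖ * (Real.exp (-α * t) * (1 / α)) := by
    rw [← ContinuousLinearMap.intervalIntegral_comp_comm _
      (hPc.intervalIntegrable _ _)]
    refine (intervalIntegral.norm_integral_le_of_norm_le ht
      (Eventually.of_forall fun s hs => h.norm_evolution_stable_pullback_le f hs.1.le hs.2)
      ((by fun_prop : Continuous fun s : ℝ =>
        K * ‖f‖ * (Real.exp (-α * t) * Real.exp (-α * s))).intervalIntegrable _ _)).trans ?_
    rw [intervalIntegral.integral_const_mul, intervalIntegral.integral_const_mul]
    refine mul_le_mul_of_nonneg_left (mul_le_mul_of_nonneg_left ?_ (Real.exp_pos _).le) hK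
    have h2 := intervalIntegral.integral_interval_add_Ioi
      (integrableOn_exp_mul_Ioi (neg_neg_of_pos hα) 0)
      (integrableOn_exp_mul_Ioi (neg_neg_of_pos hα) t)
    rw [integral_exp_mul_Ioi (neg_neg_of_pos hα), integral_exp_mul_Ioi (neg_neg_of_pos hα),
      mul_zero, Real.exp_zero, neg_div_neg_eq, neg_div_neg_eq] at h2
    have h3 : 0 ≤ Real.exp (-α * t) / α := by positivity
    linarith
  have h2 : ‖U t (∫ s in Ioi t, (1 - P) (pullback Z α f s))‖ ≤
      K * ‖f‖ * (Real.exp (-2 * α * t) * (5 / (6 * α))) := by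
    rw [← ContinuousLinearMap.integral_comp_comm _ (h.integrableOn_central_pullback f ht)]
    have hi3 := integrableOn_exp_mul_Ioi (by linarith : -3 * α < 0) t
    have hi2 := integrableOn_exp_mul_Ioi (by linarith : -2 * α < 0) t
    refine (norm_integral_le_of_norm_le
      (((hi3.const_mul (Real.exp (α * t))).add hi2).const_mul (K * ‖f‖))
      ((ae_restrict_iff' measurableSet_Ioi).2 (Eventually.of_forall fun s hs =>
        h.norm_evolution_central_pullback_le f ht (mem_Ioi.1 hs).le))).trans_eq ?_
    rw [integral_const_mul]
    congr 1
    simp only [Pi.add_apply]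
    rw [integral_add (hi3.const_mul _) hi2, integral_const_mul,
      integral_exp_mul_Ioi (by linarith), integral_exp_mul_Ioi (by linarith)]
    have h4 : Real.exp (-2 * α * t) = Real.exp (α * t) * Real.exp (-3 * α * t) := by
      rw [← Real.exp_add]
      ring_nf
    rw [h4]
    field_simp
    ring
  have hexp : Real.exp (α * t) * Real.exp (-α * t) = 1 := by
    rw [← Real.exp_add]
    simp
  have hexp2 : Real.exp (α * t) * Real.exp (-2 * α * t) ≤ 1 := by
    rw [← Real.exp_add, Real.exp_le_one_iff]
    nlinarith
  refine (norm_sub_le _ _).trans ?_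
  rw [norm_smul, norm_smul, Real.norm_of_nonneg (Real.exp_pos _).le]
  have h5 := mul_le_mul_of_nonneg_left h1 (Real.exp_pos (α * t)).le
  have h6 := mul_le_mul_of_nonneg_left h2 (Real.exp_pos (α * t)).le
  calc _ ≤ Real.exp (α * t) * (K * ‖f‖ * (Real.exp (-α * t) * (1 / α))) +
        Real.exp (α * t) * (K * ‖f‖ * (Real.exp (-2 * α * t) * (5 / (6 * α)))) :=
        add_le_add h5 h6
    _ = K * ‖f‖ * ((Real.exp (α * t) * Real.exp (-α * t)) * (1 / α) +
        (Real.exp (α * t) * Real.exp (-2 * α * t)) * (5 / (6 * α))) := by ring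
    _ ≤ K * ‖f‖ * (1 * (1 / α) + 1 * (5 / (6 * α))) := by
        rw [hexp]
        gcongr
    _ = 11 / (6 * α) * K * ‖f‖ := by
        field_simp
        ring

theorem pullback_add (Z : ℝ → E →L[ℝ] E) (α : ℝ) (f g : ℝ →ᵇ E) :
    pullback Z α (f + g) = fun s => pullback Z α f s + pullback Z α g s := by
  ext s
  simp [pullback]

theorem pullback_smul (Z : ℝ → E →L[ℝ] E) (α : ℝ) (c : ℝ) (f : ℝ →ᵇ E) :
    pullback Z α (c • f) = fun s => c • pullback Z α f s := by
  ext s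
  simp [pullback, smul_comm c]

/-- The Green operator of an exponential splitting, in exponentially weighted variables. -/
noncomputable def green [CompleteSpace E] (h : IsExponentialSplitting U Z P K α) :
    (ℝ →ᵇ E) →L[ℝ] (ℝ →ᵇ E) :=
  LinearMap.mkContinuous
    { toFun := fun f => BoundedContinuousFunction.ofNormedAddCommGroup
        -- Only t ≥ 0 matters; `max t 0` freezes functions at negative times so that all of ℝ can
        -- serve as domain.
        (fun t => Real.exp (α * max t 0) • U (max t 0) (greenPullback Z P α f (max t 0)))
        (by
          have h1 : Continuous (greenPullback Z P α f) := continuous_iff_continuousAt.2 fun t =>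
            (h.hasDerivAt_greenPullback f t).continuousAt
          have h2 : Continuous fun t : ℝ => max t 0 := by fun_prop
          exact (by fun_prop : Continuous fun t : ℝ => Real.exp (α * max t 0)).smul
            ((h.continuous_evolution.comp h2).clm_apply (h1.comp h2)))
        _ fun t => h.norm_exp_smul_evolution_greenPullback_le f (le_max_right t 0)
      map_add' := fun f g => by
        have hadd : ∀ t, greenPullback Z P α (f + g) t =
            greenPullback Z P α f t + greenPullback Z P α g t := fun t => by
          simp only [greenPullback, pullback_add, map_add]
          rw [intervalIntegral.integral_add ((h.continuous_pullback f).intervalIntegrable _ _)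
            ((h.continuous_pullback g).intervalIntegrable _ _),
            integral_add (h.integrableOn_central_pullback f le_rfl)
              (h.integrableOn_central_pullback g le_rfl)]
          abel
        ext t
        simp [hadd]
      map_smul' := fun c f => by
        have hsmul : ∀ t, greenPullback Z P α (c • f) t = c • greenPullback Z P α f t := fun t => by
          simp only [greenPullback, pullback_smul, map_smul]
          rw [intervalIntegral.integral_smul, integral_smul, smul_sub]
        ext t
        simp [hsmul, smul_comm c] } (11 / (6 * α) * K)
    fun f => (BoundedContinuousFunction.norm_le (by
      have := h.const_nonneg
      have := h.rate_pos
      positivity)).2 fun t => h.norm_exp_smul_evolution_greenPullback_le f (le_max_right t 0)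

theorem green_apply [CompleteSpace E] (h : IsExponentialSplitting U Z P K α) (f : ℝ →ᵇ E)
    (t : ℝ) : h.green f t =
      Real.exp (α * max t 0) • U (max t 0) (greenPullback Z P α f (max t 0)) := rfl

theorem norm_green_le [CompleteSpace E] (h : IsExponentialSplitting U Z P K α) :
    ‖h.green‖ ≤ 11 / (6 * α) * K :=
  LinearMap.mkContinuous_norm_le _ (by
    have := h.const_nonneg
    have := h.rate_pos
    positivity) _

end IsExponentialSplitting

end GreenOperator

/-! ### The Taylor remainder in exponentially weighted variables -/

section ScaledRemainder

variable {T E : Type*} [TopologicalSpace T] [NormedAddCommGroup E] [NormedSpace ℝ E]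
  {v : E → E} {p : T → E} {l : T → ℝ}

/-- The second-order Taylor remainder of `v` at `p t`, with increments scaled by `l t`. -/
noncomputable def scaledRemainder (v : E → E) (p : T → E) (l : T → ℝ) (t : T) (u : E) : E :=
  (l t ^ 2)⁻¹ • (v (p t + l t • u) - v (p t) - fderiv ℝ v (p t) (l t • u))

/-- The derivative of `scaledRemainder` in the increment. -/
noncomputable def scaledRemainderDeriv (v : E → E) (p : T → E) (l : T → ℝ) (t : T) (u : E) :
    E →L[ℝ] E :=
  (l t)⁻¹ • (fderiv ℝ v (p t + l t • u) - fderiv ℝ v (p t))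

omit [TopologicalSpace T] in
theorem hasFDerivAt_scaledRemainder (hv : ContDiff ℝ 2 v) (hl : ∀ t, 0 < l t) (t : T) (u : E) :
    HasFDerivAt (scaledRemainder v p l t) (scaledRemainderDeriv v p l t u) u := by
  have h1 : HasFDerivAt (fun u : E => l t • u) (l t • ContinuousLinearMap.id ℝ E) u :=
    (hasFDerivAt_id u).const_smul (l t)
  have h2 := ((hv.differentiable (by norm_num)) (p t + l t • u)).hasFDerivAt.comp u
    (h1.const_add (p t))
  have h3 := (fderiv ℝ v (p t)).hasFDerivAt.comp u h1
  have h4 := ((h2.sub_const (v (p t))).sub h3).const_smul (l t ^ 2)⁻¹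
  refine h4.congr_fderiv ?_
  ext x
  have := (hl t).ne'
  simp only [scaledRemainderDeriv, smul_apply, sub_apply,
    ContinuousLinearMap.comp_apply, ContinuousLinearMap.id_apply, map_smul, ← smul_sub, smul_smul]
  congr 1
  field_simp

omit [TopologicalSpace T] in
theorem hasFDerivAt_scaledRemainderDeriv (hv : ContDiff ℝ 2 v) (hl : ∀ t, 0 < l t) (t : T)
    (u : E) : HasFDerivAt (scaledRemainderDeriv v p l t)
      (fderiv ℝ (fderiv ℝ v) (p t + l t • u)) u := by
  have h1 : HasFDerivAt (fun u : E => l t • u) (l t • ContinuousLinearMap.id ℝ E) u :=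
    (hasFDerivAt_id u).const_smul (l t)
  have hv1 : ContDiff ℝ 1 (fderiv ℝ v) := hv.fderiv_right (by norm_num)
  have h2 := ((hv1.differentiable (by norm_num)) (p t + l t • u)).hasFDerivAt.comp u
    (h1.const_add (p t))
  have h4 := (h2.sub_const (fderiv ℝ v (p t))).const_smul (l t)⁻¹
  refine h4.congr_fderiv ?_
  ext x
  have := (hl t).ne'
  simp [smul_smul, this]

variable [FiniteDimensional ℝ E]

/-- Bounded base points and scales at most 1 keep all arguments in a compact ball, where D²v is
bounded and uniformly continuous. The lower orders then follow by integration, through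
`IsSuperposable.of_hasFDerivAt`. -/
theorem isSuperposable_fderiv_fderiv (hv : ContDiff ℝ 2 v) (hp : Continuous p) {B : ℝ}
    (hB : ∀ t, ‖p t‖ ≤ B) (hlc : Continuous l) (hl : ∀ t, 0 < l t) (hl1 : ∀ t, l t ≤ 1) :
    IsSuperposable fun t u => fderiv ℝ (fderiv ℝ v) (p t + l t • u) := by
  have hv1 : ContDiff ℝ 1 (fderiv ℝ v) := hv.fderiv_right (by norm_num)
  have hc : Continuous (fderiv ℝ (fderiv ℝ v)) := hv1.continuous_fderiv (by norm_num)
  have hsmul : ∀ t (u : E), ‖l t • u‖ ≤ ‖u‖ := fun t u => by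
    rw [norm_smul, Real.norm_of_nonneg (hl t).le]
    exact mul_le_of_le_one_left (norm_nonneg _) (hl1 t)
  have hball : ∀ ρ t (u : E), ‖u‖ ≤ ρ → p t + l t • u ∈ Metric.closedBall (0 : E) (B + ρ) :=
    fun ρ t u hu => by
      rw [mem_closedBall_zero_iff]
      exact (norm_add_le _ _).trans (add_le_add (hB t) ((hsmul t u).trans hu))
  have : ProperSpace E := FiniteDimensional.proper ℝ E
  refine ⟨?_, fun ρ => ?_, fun ρ ε hε => ?_⟩
  · exact hc.comp ((hp.comp continuous_fst).add ((hlc.comp continuous_fst).smul continuous_snd))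
  · obtain ⟨A, hA⟩ := ((isCompact_closedBall (0 : E) (B + ρ)).image hc.norm).bddAbove
    exact ⟨A, fun t u hu => hA (mem_image_of_mem _ (hball ρ t u hu))⟩
  · obtain ⟨δ, hδ, h⟩ := Metric.uniformContinuousOn_iff.1
      ((isCompact_closedBall (0 : E) (B + ρ)).uniformContinuousOn_of_continuous hc.continuousOn)
      ε hε
    refine ⟨δ, hδ, fun t u u' hu hu' huu' => ?_⟩
    rw [← dist_eq_norm]
    refine (h _ (hball ρ t u hu) _ (hball ρ t u' hu') ?_).le
    rw [dist_add_left, dist_eq_norm, ← smul_sub]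
    exact (hsmul t _).trans_lt huu'

theorem isSuperposable_scaledRemainderDeriv (hv : ContDiff ℝ 2 v) (hp : Continuous p) {B : ℝ}
    (hB : ∀ t, ‖p t‖ ≤ B) (hlc : Continuous l) (hl : ∀ t, 0 < l t) (hl1 : ∀ t, l t ≤ 1) :
    IsSuperposable (scaledRemainderDeriv v p l) := by
  have hc : Continuous (fderiv ℝ v) := hv.continuous_fderiv (by norm_num)
  refine (isSuperposable_fderiv_fderiv hv hp hB hlc hl hl1).of_hasFDerivAt
    (hasFDerivAt_scaledRemainderDeriv hv hl) ?_ fun t => by simp [scaledRemainderDeriv]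
  have hp' : Continuous fun q : T × E => p q.1 := hp.comp continuous_fst
  have hl' : Continuous fun q : T × E => l q.1 := hlc.comp continuous_fst
  exact (hl'.inv₀ fun q => (hl q.1).ne').smul
    ((hc.comp (hp'.add (hl'.smul continuous_snd))).sub (hc.comp hp'))

theorem isSuperposable_scaledRemainder (hv : ContDiff ℝ 2 v) (hp : Continuous p) {B : ℝ}
    (hB : ∀ t, ‖p t‖ ≤ B) (hlc : Continuous l) (hl : ∀ t, 0 < l t) (hl1 : ∀ t, l t ≤ 1) :
    IsSuperposable (scaledRemainder v p l) := by
  have hc : Continuous (fderiv ℝ v) := hv.continuous_fderiv (by norm_num)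
  refine (isSuperposable_scaledRemainderDeriv hv hp hB hlc hl hl1).of_hasFDerivAt
    (hasFDerivAt_scaledRemainder hv hl) ?_ fun t => by simp [scaledRemainder]
  have hp' : Continuous fun q : T × E => p q.1 := hp.comp continuous_fst
  have hl' : Continuous fun q : T × E => l q.1 := hlc.comp continuous_fst
  have hlu : Continuous fun q : T × E => l q.1 • q.2 := hl'.smul continuous_snd
  exact ((hl'.pow 2).inv₀ fun q => (pow_pos (hl q.1) 2).ne').smul
    (((hv.continuous.comp (hp'.add hlu)).sub (hv.continuous.comp hp')).sub
      ((hc.comp hp').clm_apply hlu))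

/-- The factor (l t)⁻¹ cancels the l t in the increment l t • u t, so the constant C is not affected
by the weight. -/
theorem norm_fderiv_superpose_scaledRemainder_le (hv : ContDiff ℝ 2 v) (hp : Continuous p) {B : ℝ}
    (hB : ∀ t, ‖p t‖ ≤ B) (hlc : Continuous l) (hl : ∀ t, 0 < l t) (hl1 : ∀ t, l t ≤ 1)
    {C : ℝ} (hC : 0 ≤ C)
    (hvC : ∀ t y, ‖y‖ ≤ 1 → ‖fderiv ℝ v (p t + y) - fderiv ℝ v (p t)‖ ≤ C * ‖y‖)
    (u : T →ᵇ E) (hu : ‖u‖ ≤ 1) :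
    ‖fderiv ℝ (superpose _ (isSuperposable_scaledRemainder hv hp hB hlc hl hl1)) u‖ ≤ C * ‖u‖ := by
  rw [(hasFDerivAt_superpose _ (isSuperposable_scaledRemainderDeriv hv hp hB hlc hl hl1)
    (hasFDerivAt_scaledRemainder hv hl) u).fderiv]
  refine (norm_pointwiseApply_le _).trans ?_
  refine (BoundedContinuousFunction.norm_le (mul_nonneg hC (norm_nonneg u))).2 fun t => ?_
  rw [superpose_apply, scaledRemainderDeriv, norm_smul, norm_inv,
    Real.norm_of_nonneg (hl t).le, inv_mul_le_iff₀ (hl t)]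
  have h1 : ‖l t • u t‖ = l t * ‖u t‖ := by
    rw [norm_smul, Real.norm_of_nonneg (hl t).le]
  have h2 := u.norm_coe_le_norm t
  refine (hvC t (l t • u t) ?_).trans ?_
  · rw [h1]
    exact mul_le_one₀ (hl1 t) (norm_nonneg _) (h2.trans hu)
  · rw [h1, mul_left_comm]
    gcongr
    exact (hl t).le

end ScaledRemainder

/-! ### The Lyapunov–Perron equation and a single stable fibre -/

section LyapunovPerron

set_option linter.unusedSectionVars false

open MeasureTheory

variable {E : Type*} [NormedAddCommGroup E] [InnerProductSpace ℝ E] [FiniteDimensional ℝ E]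
  {U Z : ℝ → E →L[ℝ] E} {P : E →L[ℝ] E} {K α : ℝ}

/-- The forward orbits in the range of `P` of the linear evolution, exponentially weighted. -/
noncomputable def IsExponentialSplitting.stableOrbit (h : IsExponentialSplitting U Z P K α) :
    E →L[ℝ] (ℝ →ᵇ E) :=
  have hbound : ∀ η t, ‖Real.exp (α * max t 0) • U (max t 0) (P η)‖ ≤ K * ‖η‖ := fun η t => by
    have h1 := h.norm_stable_le 0 (max t 0) le_rfl (le_max_right t 0)
    rw [h.inverse_zero, mul_one, sub_zero] at h1
    rw [norm_smul, Real.norm_of_nonneg (Real.exp_pos _).le]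
    have h2 : ‖U (max t 0) (P η)‖ ≤ K * Real.exp (-α * max t 0) * ‖η‖ :=
      ((U (max t 0) * P).le_opNorm η).trans
        (mul_le_mul_of_nonneg_right h1 (norm_nonneg _))
    have h3 : Real.exp (α * max t 0) * Real.exp (-α * max t 0) = 1 := by
      rw [← Real.exp_add]
      simp
    calc _ ≤ Real.exp (α * max t 0) * (K * Real.exp (-α * max t 0) * ‖η‖) :=
          mul_le_mul_of_nonneg_left h2 (Real.exp_pos _).le
      _ = (Real.exp (α * max t 0) * Real.exp (-α * max t 0)) * (K * ‖η‖) := by ring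
      _ = K * ‖η‖ := by rw [h3, one_mul]
  LinearMap.mkContinuous
    { toFun := fun η => BoundedContinuousFunction.ofNormedAddCommGroup
        -- Inserting P gives a bounded linear map on all of E, the form needed for smooth dependence
        -- on η.
        (fun t => Real.exp (α * max t 0) • U (max t 0) (P η))
        (by
          have h2 : Continuous fun t : ℝ => max t 0 := by fun_prop
          exact (by fun_prop : Continuous fun t : ℝ => Real.exp (α * max t 0)).smul
            ((h.continuous_evolution.comp h2).clm_apply continuous_const))
        (K * ‖η‖) (hbound η)
      map_add' := fun η ζ => by ext t; simp
      map_smul' := fun c η => by ext t; simp [smul_comm c] } K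
    fun η => by
      refine BoundedContinuousFunction.norm_ofNormedAddCommGroup_le _ ?_ (hbound η)
      exact mul_nonneg h.const_nonneg (norm_nonneg _)

theorem IsExponentialSplitting.stableOrbit_apply (h : IsExponentialSplitting U Z P K α) (η : E)
    (t : ℝ) : h.stableOrbit η t = Real.exp (α * max t 0) • U (max t 0) (P η) := rfl

/-- On stable vectors the constant is c instead of K, which is why the smallness condition contains
c r. -/
theorem IsExponentialSplitting.norm_stableOrbit_le (h : IsExponentialSplitting U Z P K α) {c : ℝ}
    (hc : 0 ≤ c) {η : E} (hη : ∀ t, 0 ≤ t → ‖U t (P η)‖ ≤ c * Real.exp (-α * t) * ‖η‖) :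
    ‖h.stableOrbit η‖ ≤ c * ‖η‖ := by
  refine (BoundedContinuousFunction.norm_le (by positivity)).2 fun t => ?_
  rw [h.stableOrbit_apply, norm_smul, Real.norm_of_nonneg (Real.exp_pos _).le]
  have h3 : Real.exp (α * max t 0) * Real.exp (-α * max t 0) = 1 := by
    rw [← Real.exp_add]
    simp
  calc _ ≤ Real.exp (α * max t 0) * (c * Real.exp (-α * max t 0) * ‖η‖) :=
        mul_le_mul_of_nonneg_left (hη _ (le_max_right t 0)) (Real.exp_pos _).le
    _ = (Real.exp (α * max t 0) * Real.exp (-α * max t 0)) * (c * ‖η‖) := by ring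
    _ = c * ‖η‖ := by rw [h3, one_mul]

variable {v : E → E} {χ : Flow ℝ E} {ξ : E}

/-- The remainder of `v` along the forward orbit of `ξ`, in variables weighted by `e^{αt}`. -/
noncomputable def orbitRemainder (v : E → E) (χ : Flow ℝ E) (ξ : E) (α : ℝ) : ℝ → E → E :=
  scaledRemainder v (fun t => χ (max t 0) ξ) fun t => Real.exp (-α * max t 0)

theorem isSuperposable_orbitRemainder (hχ : GeneratesFlow v χ) (hv : ContDiff ℝ 2 v) {B : ℝ}
    (hB : ∀ t, ‖χ t ξ‖ ≤ B) (hα : 0 < α) : IsSuperposable (orbitRemainder v χ ξ α) :=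
  isSuperposable_scaledRemainder hv
    ((hχ.continuous_orbit ξ).comp (by fun_prop : Continuous fun t : ℝ => max t 0))
    (fun t => hB _) (by fun_prop) (fun t => Real.exp_pos _)
    fun t => Real.exp_le_one_iff.2 (by nlinarith [le_max_right t 0])

omit [FiniteDimensional ℝ E] in
-- The weight e^{-2αt} in `pullback` cancels the normalisation of the quadratic remainder, which
-- leads back to the unweighted equation.
theorem pullback_superpose_orbitRemainder
    (hS : IsSuperposable (orbitRemainder v χ ξ α)) (Z : ℝ → E →L[ℝ] E) (u : ℝ →ᵇ E)
    {t : ℝ} (ht : 0 ≤ t) {y : E} (hy : Real.exp (-α * t) • u t = y) :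
    pullback Z α (superpose _ hS u) t =
      Z t (v (χ t ξ + y) - v (χ t ξ) - fderiv ℝ v (χ t ξ) y) := by
  have h1 : Real.exp (-2 * α * t) * (Real.exp (-α * t) ^ 2)⁻¹ = 1 := by
    rw [← Real.exp_nat_mul, ← Real.exp_neg, ← Real.exp_add, Real.exp_eq_one_iff]
    push_cast
    ring
  rw [pullback, superpose_apply, orbitRemainder, scaledRemainder, max_eq_left ht, hy, map_smul,
    smul_smul, h1, one_smul]

/-- A fixed point of the Lyapunov–Perron operator is an orbit of the flow. -/
theorem flow_sub_eq_of_eq_stableOrbit_add_green (hχ : GeneratesFlow v χ) (hv : ContDiff ℝ 2 v)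
    (h : IsExponentialSplitting U Z P K α)
    (hU : ∀ t, HasDerivAt U (fderiv ℝ v (χ t ξ) * U t) t)
    (hS : IsSuperposable (orbitRemainder v χ ξ α)) {η : E} (hη : P η = η) {u : ℝ →ᵇ E}
    (hu : u = h.stableOrbit η + h.green (superpose _ hS u)) {t : ℝ} (ht : 0 ≤ t) :
    χ t (ξ + η + h.green (superpose _ hS u) 0) - χ t ξ = Real.exp (-α * t) • u t := by
  set f := superpose _ hS u with hf
  -- Variation of constants: U applied to a primitive of the pulled-back inhomogeneity.
  set y : ℝ → E := fun s => U s (η + greenPullback Z P α f s) with hy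
  have hyu : ∀ s, 0 ≤ s → Real.exp (-α * s) • u s = y s := fun s hs => by
    have h1 : u s = h.stableOrbit η s + h.green f s := congrArg (fun w : ℝ →ᵇ E => w s) hu
    have h3 : Real.exp (-α * s) * Real.exp (α * s) = 1 := by
      rw [← Real.exp_add]
      simp
    rw [h1, h.stableOrbit_apply, h.green_apply, max_eq_left hs, ← smul_add, ← map_add, hη,
      smul_smul, h3, one_smul]
  have hyd : ∀ s, 0 ≤ s → HasDerivAt (fun s => χ s ξ + y s) (v (χ s ξ + y s)) s := fun s hs => by
    have h1 := (hU s).clm_apply ((h.hasDerivAt_greenPullback f s).const_add η)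
    rw [pullback_superpose_orbitRemainder hS Z u hs (hyu s hs), h.evolution_apply_inverse] at h1
    refine ((hχ ξ s).add h1).congr_deriv ?_
    simp only [hy, ContinuousLinearMap.mul_def, ContinuousLinearMap.comp_apply]
    abel
  have h0 : χ 0 ξ + y 0 = ξ + η + h.green f 0 := by
    rw [h.green_apply, χ.map_zero_apply]
    simp [hy, h.evolution_zero, add_assoc]
  have h2 := hχ.eq_of_hasDerivAt (hv.of_le (by norm_num)) hyd ht
  rw [h0] at h2
  rw [← h2, add_sub_cancel_left, hyu t ht]

/-- An orbit approaching that of `ξ` exponentially is a fixed point of the Lyapunov–Perron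
operator. -/
theorem exists_eq_stableOrbit_add_green_of_flow_sub_le (hχ : GeneratesFlow v χ)
    (h : IsExponentialSplitting U Z P K α)
    (hZ : ∀ t, HasDerivAt Z (-(Z t * fderiv ℝ v (χ t ξ))) t)
    (hS : IsSuperposable (orbitRemainder v χ ξ α)) {x : E} {R : ℝ}
    (hx : ∀ t, 0 ≤ t → ‖χ t x - χ t ξ‖ ≤ R * Real.exp (-α * t)) :
    ∃ u : ℝ →ᵇ E, ‖u‖ ≤ R ∧ u 0 = x - ξ ∧
      u = h.stableOrbit (P (x - ξ)) + h.green (superpose _ hS u) := by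
  have hα := h.rate_pos
  have hR : 0 ≤ R := by simpa using (norm_nonneg _).trans (hx 0 le_rfl)
  have hexp : ∀ s, Real.exp (-α * s) * Real.exp (α * s) = 1 := fun s => by
    rw [← Real.exp_add]
    simp
  have hb : ∀ t : ℝ, ‖Real.exp (α * max t 0) • (χ (max t 0) x - χ (max t 0) ξ)‖ ≤ R := fun t => by
    rw [norm_smul, Real.norm_of_nonneg (Real.exp_pos _).le]
    refine (mul_le_mul_of_nonneg_left (hx _ (le_max_right t 0)) (Real.exp_pos _).le).trans_eq ?_
    rw [mul_left_comm, mul_comm (Real.exp _), hexp, mul_one]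
  let u : ℝ →ᵇ E := BoundedContinuousFunction.ofNormedAddCommGroup
    (fun t => Real.exp (α * max t 0) • (χ (max t 0) x - χ (max t 0) ξ)) (by fun_prop) R hb
  have hut : ∀ t, u t = Real.exp (α * max t 0) • (χ (max t 0) x - χ (max t 0) ξ) := fun t => rfl
  set f := superpose _ hS u with hf
  have hyu : ∀ s, 0 ≤ s → Real.exp (-α * s) • u s = χ s x - χ s ξ := fun s hs => by
    rw [hut, max_eq_left hs, smul_smul, hexp, one_smul]
  set z : ℝ → E := fun s => Z s (χ s x - χ s ξ) with hz
  have hzd : ∀ s, 0 ≤ s → HasDerivAt z (pullback Z α f s) s := fun s hs => by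
    have h1 := (hZ s).clm_apply ((hχ x s).sub (hχ ξ s))
    refine h1.congr_deriv ?_
    rw [hf, pullback_superpose_orbitRemainder hS Z u hs (hyu s hs)]
    simp only [add_sub_cancel, map_sub, neg_apply, ContinuousLinearMap.mul_def, ContinuousLinearMap.comp_apply, Pi.sub_apply]
    abel
  have hz0 : z 0 = x - ξ := by
    simp [hz, h.inverse_zero, χ.map_zero_apply]
  have hc := h.continuous_pullback f
  -- (1 - P) Z is bounded on s ≥ 0 and the difference of orbits decays. Hence (1 - P) z(0) is minus
  -- the integral of (1 - P) z' over (0, ∞), which leaves only the stable component of the initial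
  -- value free.
  have hQ : Tendsto (fun s => (1 - P) (z s)) atTop (𝓝 0) := by
    have hlim : Tendsto (fun s => K * 2 * (R * Real.exp (-α * s))) atTop (𝓝 0) := by
      have h1 : Tendsto (fun s => -α * s) atTop atBot := by
        simpa using (tendsto_const_mul_atTop_of_pos hα).2 tendsto_id
      simpa using ((Real.tendsto_exp_atBot.comp h1).const_mul R).const_mul (K * 2)
    refine squeeze_zero_norm' ?_ hlim
    filter_upwards [eventually_ge_atTop (0 : ℝ)] with s hs
    have h1 : ‖(1 - P) * Z s‖ ≤ K * 2 := by
      have h2 := h.norm_central_le s 0 le_rfl hs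
      rw [h.evolution_zero, one_mul] at h2
      refine h2.trans (mul_le_mul_of_nonneg_left ?_ h.const_nonneg)
      have : Real.exp (α * (0 - s)) ≤ 1 := Real.exp_le_one_iff.2 (by nlinarith)
      linarith
    exact (((1 - P) * Z s).le_opNorm _).trans
      (mul_le_mul h1 (hx s hs) (norm_nonneg _) (by linarith [h.const_nonneg]))
  have hint := integral_Ioi_of_hasDerivAt_of_tendsto'
    (fun s (hs : s ∈ Ici (0 : ℝ)) => (1 - P).hasFDerivAt.comp_hasDerivAt s (hzd s hs))
    (h.integrableOn_central_pullback f le_rfl) hQ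
  have hzt : ∀ t, 0 ≤ t → z t = P (x - ξ) + greenPullback Z P α f t := fun t ht => by
    have h1 := intervalIntegral.integral_eq_sub_of_hasDerivAt
      (fun s (hs : s ∈ uIcc 0 t) => hzd s (by rw [uIcc_of_le ht] at hs; exact hs.1))
      (hc.intervalIntegrable 0 t)
    rw [greenPullback, h1, hint]
    simp [hz0]
  refine ⟨u, (BoundedContinuousFunction.norm_le hR).2 hb, by simp [hut, χ.map_zero_apply], ?_⟩
  ext t
  rw [BoundedContinuousFunction.add_apply, h.stableOrbit_apply, h.green_apply,
    h.proj_apply_proj, ← smul_add, ← map_add, ← hzt _ (le_max_right t 0), hut, hz,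
    h.evolution_apply_inverse]

/-- The local strong stable fibre of a point with bounded orbit and exponentially split
variational equation, as a `C²` graph over the stable subspace. -/
theorem exists_stable_fibre (hχ : GeneratesFlow v χ) (hv : ContDiff ℝ 2 v) {B : ℝ}
    (hB : ∀ t, ‖χ t ξ‖ ≤ B) (h : IsExponentialSplitting U Z P K α)
    (hU : ∀ t, HasDerivAt U (fderiv ℝ v (χ t ξ) * U t) t)
    (hZ : ∀ t, HasDerivAt Z (-(Z t * fderiv ℝ v (χ t ξ))) t)
    {c : ℝ} (hc : 0 ≤ c) (hUc : ∀ η, P η = η → ∀ t, 0 ≤ t →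
      ‖U t η‖ ≤ c * Real.exp (-α * t) * ‖η‖)
    {C : ℝ} (hC : 0 ≤ C)
    (hvC : ∀ t, 0 ≤ t → ∀ y, ‖y‖ ≤ 1 →
      ‖fderiv ℝ v (χ t ξ + y) - fderiv ℝ v (χ t ξ)‖ ≤ C * ‖y‖)
    {r R : ℝ} (hR : 0 ≤ R) (hR1 : R < 1)
    (hrR : c * r + 11 / (6 * α) * K * C * R ^ 2 ≤ R)
    (hRK : 2 * (11 / (6 * α) * K * C * R) < 1) :
    ∃ k : E → E, (∀ η, P η = η → ‖η‖ < r → P (k η) = 0 ∧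
        ‖k η‖ ≤ 11 / (6 * α) * K * C * (2 * c) ^ 2 * ‖η‖ ^ 2 ∧
        (∀ t, 0 ≤ t → ‖χ t (ξ + η + k η) - χ t ξ‖ ≤ R * Real.exp (-α * t)) ∧
        ∀ k', P k' = 0 → (∀ t, 0 ≤ t →
          ‖χ t (ξ + η + k') - χ t ξ‖ ≤ R * Real.exp (-α * t)) → k' = k η) ∧
      ∀ L : Submodule ℝ E, (∀ η ∈ L, P η = η) →
        ContDiffOn ℝ 2 (fun η : L => k η) (Metric.ball 0 r) := by
  have hα := h.rate_pos
  have hS := isSuperposable_orbitRemainder hχ hv hB hα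
  set S := superpose _ hS with hSdef
  have hmax : Continuous fun t : ℝ => χ (max t 0) ξ :=
    (hχ.continuous_orbit ξ).comp (by fun_prop : Continuous fun t : ℝ => max t 0)
  have hlc : Continuous fun t : ℝ => Real.exp (-α * max t 0) := by fun_prop
  have hl0 : ∀ t : ℝ, 0 < Real.exp (-α * max t 0) := fun t => Real.exp_pos _
  have hl1 : ∀ t : ℝ, Real.exp (-α * max t 0) ≤ 1 := fun t =>
    Real.exp_le_one_iff.2 (by nlinarith [le_max_right t 0])
  have hS2 : ContDiff ℝ 2 S := contDiff_two_superpose hS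
    (isSuperposable_scaledRemainderDeriv hv hmax (fun t => hB _) hlc hl0 hl1)
    (isSuperposable_fderiv_fderiv hv hmax (fun t => hB _) hlc hl0 hl1)
    (hasFDerivAt_scaledRemainder hv hl0) (hasFDerivAt_scaledRemainderDeriv hv hl0)
  have hSd : Differentiable ℝ S := hS2.differentiable (by norm_num)
  have hS0 : S 0 = 0 := by
    ext t
    simp [hSdef, orbitRemainder, scaledRemainder]
  have hSC : ∀ u : ℝ →ᵇ E, ‖u‖ ≤ 1 → ‖fderiv ℝ S u‖ ≤ C * ‖u‖ :=
    norm_fderiv_superpose_scaledRemainder_le hv hmax (fun t => hB _) hlc hl0 hl1 hC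
      fun t y hy => hvC _ (le_max_right t 0) y hy
  have hG := h.norm_green_le
  have ha : ∀ η, P η = η → ‖h.stableOrbit η‖ ≤ c * ‖η‖ := fun η hη =>
    h.norm_stableOrbit_le hc fun t ht => by
      rw [hη]
      exact hUc η hη t ht
  have hex : ∀ η, P η = η → ‖η‖ < r →
      ∃ u, ‖u‖ ≤ R ∧ u = h.stableOrbit η + h.green (S u) := fun η hη hηr =>
    exists_eq_add_clm_comp hSd hS0 hG hC hSC hR hR1 hRK (by
      have := ha η hη
      have := mul_le_mul_of_nonneg_left hηr.le hc
      linarith)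
  choose! u huR hu using hex
  have hgreen0 : ∀ w, h.green w 0 = greenPullback Z P α w 0 := fun w => by
    simp [h.green_apply, h.evolution_zero]
  -- At time zero u = η + G(S u)(0), so the second term is the correction to η.
  refine ⟨fun η => h.green (S (u η)) 0, fun η hη hηr => ⟨?_, ?_, ?_, ?_⟩, ?_⟩
  · beta_reduce
    rw [hgreen0]
    exact h.proj_greenPullback_zero _
  -- Comparison with the zero solution for η = 0; this is the source of (2c)² in the quadratic
  -- bound.
  · have hu2 : ‖u η‖ ≤ 2 * c * ‖η‖ := by
      have h1 := norm_sub_le_of_eq_add_clm_comp hSd hG hC hSC hR1 hRK (huR η hη hηr)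
        (u' := 0) (a' := 0) (by simpa using hR) (hu η hη hηr) (by simp [hS0])
      rw [sub_zero, sub_zero] at h1
      linarith [ha η hη]
    have h2 := norm_sub_le_of_norm_fderiv_le_mul_norm hSd hC hSC
      ((huR η hη hηr).trans hR1.le) le_rfl (u' := 0) (by simp)
    rw [hS0, sub_zero, sub_zero] at h2
    have hK := h.const_nonneg
    calc ‖h.green (S (u η)) 0‖ ≤ ‖h.green (S (u η))‖ :=
          BoundedContinuousFunction.norm_coe_le_norm _ _
      _ ≤ 11 / (6 * α) * K * ‖S (u η)‖ :=
          ContinuousLinearMap.le_of_opNorm_le _ hG _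
      _ ≤ 11 / (6 * α) * K * (C * (2 * c * ‖η‖) * (2 * c * ‖η‖)) := by
          refine mul_le_mul_of_nonneg_left (h2.trans ?_) (by positivity)
          gcongr
      _ = _ := by ring
  · intro t ht
    rw [flow_sub_eq_of_eq_stableOrbit_add_green hχ hv h hU hS hη (hu η hη hηr) ht, norm_smul,
      Real.norm_of_nonneg (Real.exp_pos _).le, mul_comm]
    exact mul_le_mul_of_nonneg_right (((u η).norm_coe_le_norm t).trans (huR η hη hηr))
      (Real.exp_pos _).le
  · intro k' hk' hdecay
    -- A competitor yields a fixed point in the same ball with the same linear term, hence the same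
    -- u.
    obtain ⟨w, hwR, hw0, hw⟩ := exists_eq_stableOrbit_add_green_of_flow_sub_le hχ h hZ hS hdecay
    have hsub : ξ + η + k' - ξ = η + k' := by abel
    rw [hsub, map_add, hη, hk', add_zero] at hw
    have h1 := norm_sub_le_of_eq_add_clm_comp hSd hG hC hSC hR1 hRK hwR (huR η hη hηr) hw
      (hu η hη hηr)
    rw [sub_self, norm_zero, mul_zero] at h1
    have h2 : w = u η := sub_eq_zero.1 (norm_le_zero_iff.1 h1)
    have h3 : w 0 = h.stableOrbit η 0 + h.green (S w) 0 := congrArg (fun q : ℝ →ᵇ E => q 0) hw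
    have h4 : h.stableOrbit η 0 = η := by
      simp [h.stableOrbit_apply, h.evolution_zero, hη]
    rw [hw0, hsub, h4] at h3
    beta_reduce
    rw [← h2]
    exact add_left_cancel h3
  · intro L hL
    have hfix : ∀ η : L, η ∈ Metric.ball (0 : L) r → ‖u η‖ ≤ R ∧
        u η = (h.stableOrbit.comp L.subtypeL) η + h.green (S (u η)) := fun η hη => by
      have hηr : ‖(η : E)‖ < r := by simpa using hη
      exact ⟨huR η (hL η η.2) hηr, hu η (hL η η.2) hηr⟩
    have h1 : ContDiffOn ℝ 2 (fun η : L => u η) (Metric.ball 0 r) :=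
      contDiffOn_of_eq_add_clm_comp hS2 hG hC hSC hR1 hRK (h.stableOrbit.comp L.subtypeL)
        Metric.isOpen_ball (fun η hη => (hfix η hη).1) fun η hη => (hfix η hη).2
    exact ((BoundedContinuousFunction.evalCLM ℝ (0 : ℝ)).contDiff.comp
      (h.green.contDiff.comp hS2)).comp_contDiffOn h1

end LyapunovPerron

/-! ### Oblique projections -/

section ObliqueProjection

variable {E : Type*} [NormedAddCommGroup E] [InnerProductSpace ℝ E] [FiniteDimensional ℝ E]

theorem obliqueProj_apply {p q : Submodule ℝ E} (h : IsCompl p q) (x : E) :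
    obliqueProj p q x = p.projection q h x := by
  rw [obliqueProj, dif_pos h]
  rfl

theorem obliqueProj_add {p q : Submodule ℝ E} (h : IsCompl p q) {a b : E} (ha : a ∈ p)
    (hb : b ∈ q) : obliqueProj p q (a + b) = a := by
  rw [map_add, obliqueProj_apply h, obliqueProj_apply h,
    (Submodule.projection_apply_eq_zero_iff h).2 hb, add_zero]
  exact Submodule.projection_apply_left h ⟨a, ha⟩

theorem obliqueProj_mem {p q : Submodule ℝ E} (h : IsCompl p q) (x : E) :
    obliqueProj p q x ∈ p := by
  rw [obliqueProj_apply h]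
  exact Submodule.projection_apply_mem h x

theorem mem_of_obliqueProj_eq_zero {p q : Submodule ℝ E} (h : IsCompl p q) {x : E}
    (hx : obliqueProj p q x = 0) : x ∈ q := by
  rw [obliqueProj_apply h] at hx
  exact (Submodule.projection_apply_eq_zero_iff h).1 hx

end ObliqueProjection

/-! ### Continuity of the hyperbolic splitting and its exponential estimates -/

namespace IsHyperbolicAlong

variable {E : Type*} [NormedAddCommGroup E] [InnerProductSpace ℝ E] [FiniteDimensional ℝ E]
  {v : E → E} {χ : Flow ℝ E} {M : Set E} {Lm Lp : E → Submodule ℝ E} {c α : ℝ} {x : E}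

theorem obliqueProj_minus_add_add (hyp : IsHyperbolicAlong v χ M Lm Lp c α) (hx : x ∈ M)
    {a b n : E} (ha : a ∈ Lm x) (hb : b ∈ Lp x) (hn : n ∈ neutralSpace v x) :
    obliqueProj (Lm x) (Lp x ⊔ neutralSpace v x) (a + b + n) = a := by
  rw [add_assoc]
  exact obliqueProj_add (hyp.isCompl_minus x hx) ha (Submodule.add_mem_sup hb hn)

theorem obliqueProj_plus_add_add (hyp : IsHyperbolicAlong v χ M Lm Lp c α) (hx : x ∈ M)
    {a b n : E} (ha : a ∈ Lm x) (hb : b ∈ Lp x) (hn : n ∈ neutralSpace v x) :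
    obliqueProj (Lp x) (Lm x ⊔ neutralSpace v x) (a + b + n) = b := by
  rw [add_comm a, add_assoc]
  exact obliqueProj_add (hyp.isCompl_plus x hx) hb (Submodule.add_mem_sup ha hn)

theorem obliqueProj_zero_add_add (hyp : IsHyperbolicAlong v χ M Lm Lp c α) (hx : x ∈ M)
    {a b n : E} (ha : a ∈ Lm x) (hb : b ∈ Lp x) (hn : n ∈ neutralSpace v x) :
    obliqueProj (neutralSpace v x) (Lm x ⊔ Lp x) (a + b + n) = n := by
  rw [add_comm]
  exact obliqueProj_add (hyp.isCompl_zero x hx) hn (Submodule.add_mem_sup ha hb)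

/-- The decomposition of a vector into its stable, unstable and neutral components. -/
theorem obliqueProj_add_obliqueProj_add_obliqueProj (hyp : IsHyperbolicAlong v χ M Lm Lp c α)
    (hx : x ∈ M) (z : E) : obliqueProj (Lm x) (Lp x ⊔ neutralSpace v x) z +
      obliqueProj (Lp x) (Lm x ⊔ neutralSpace v x) z +
      obliqueProj (neutralSpace v x) (Lm x ⊔ Lp x) z = z := by
  obtain ⟨a, ha, q, hq, rfl⟩ := Submodule.mem_sup.1
    (show z ∈ Lm x ⊔ (Lp x ⊔ neutralSpace v x) by
      rw [(hyp.isCompl_minus x hx).sup_eq_top]; trivial)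
  obtain ⟨b, hb, n, hn, rfl⟩ := Submodule.mem_sup.1 hq
  rw [← add_assoc, hyp.obliqueProj_minus_add_add hx ha hb hn,
    hyp.obliqueProj_plus_add_add hx ha hb hn, hyp.obliqueProj_zero_add_add hx ha hb hn]

/-- The projections of the hyperbolic decomposition depend continuously on the point. -/
theorem continuousOn_obliqueProj (hyp : IsHyperbolicAlong v χ M Lm Lp c α) (hv : Continuous v) :
    ContinuousOn (fun x => obliqueProj (Lm x) (Lp x ⊔ neutralSpace v x)) M ∧
    ContinuousOn (fun x => obliqueProj (Lp x) (Lm x ⊔ neutralSpace v x)) M ∧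
    ContinuousOn (fun x => obliqueProj (neutralSpace v x) (Lm x ⊔ Lp x)) M := by
  suffices h : ∀ x₀ ∈ M,
      ContinuousWithinAt (fun x => obliqueProj (Lm x) (Lp x ⊔ neutralSpace v x)) M x₀ ∧
      ContinuousWithinAt (fun x => obliqueProj (Lp x) (Lm x ⊔ neutralSpace v x)) M x₀ ∧
      ContinuousWithinAt (fun x => obliqueProj (neutralSpace v x) (Lm x ⊔ Lp x)) M x₀ from
    ⟨fun x hx => (h x hx).1, fun x hx => (h x hx).2.1, fun x hx => (h x hx).2.2⟩
  intro x₀ hx₀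
  have : CompleteSpace E := FiniteDimensional.complete ℝ E
  set A := obliqueProj (Lm x₀) (Lp x₀ ⊔ neutralSpace v x₀) with hA
  set B := obliqueProj (Lp x₀) (Lm x₀ ⊔ neutralSpace v x₀) with hB
  set N := obliqueProj (neutralSpace v x₀) (Lm x₀ ⊔ Lp x₀) with hN
  obtain ⟨f, hf⟩ : ∃ f : E →L[ℝ] ℝ, f.smulRight (v x₀) = N := by
    refine ⟨(‖v x₀‖ ^ 2)⁻¹ • (innerSL ℝ (v x₀)).comp N, ?_⟩
    ext z
    obtain ⟨a, ha⟩ := Submodule.mem_span_singleton.1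
      (obliqueProj_mem (hyp.isCompl_zero x₀ hx₀) z)
    have hv0 : ‖v x₀‖ ≠ 0 := norm_ne_zero_iff.2 (hyp.ne_zero x₀ hx₀)
    have ha' : N z = a • v x₀ := ha.symm
    simp only [ContinuousLinearMap.smulRight_apply, smul_apply, ContinuousLinearMap.comp_apply,
      ha', innerSL_apply_apply, inner_smul_right, real_inner_self_eq_norm_sq, smul_eq_mul]
    field_simp
  -- The components at x₀ are moved into the subspaces at x. Their sum S x is the identity at x₀,
  -- hence invertible nearby, and each projection at x equals its moved component times (S x)⁻¹.
  set TA : E → E →L[ℝ] E := fun x => (Lm x).starProjection * A with hTA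
  set TB : E → E →L[ℝ] E := fun x => (Lp x).starProjection * B with hTB
  set TN : E → E →L[ℝ] E := fun x => f.smulRight (v x) with hTN
  have hTAc : ContinuousWithinAt TA M x₀ :=
    (hyp.continuousOn_minus x₀ hx₀).mul continuousWithinAt_const
  have hTBc : ContinuousWithinAt TB M x₀ :=
    (hyp.continuousOn_plus x₀ hx₀).mul continuousWithinAt_const
  have hTNc : ContinuousWithinAt TN M x₀ :=
    ((ContinuousLinearMap.smulRightL ℝ E E f).continuous.comp hv).continuousWithinAt
  set S : E → E →L[ℝ] E := fun x => TA x + TB x + TN x with hS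
  have hSc : ContinuousWithinAt S M x₀ := (hTAc.add hTBc).add hTNc
  have hTA0 : TA x₀ = A := by
    ext z
    exact Submodule.starProjection_eq_self_iff.2 (obliqueProj_mem (hyp.isCompl_minus x₀ hx₀) z)
  have hTB0 : TB x₀ = B := by
    ext z
    exact Submodule.starProjection_eq_self_iff.2 (obliqueProj_mem (hyp.isCompl_plus x₀ hx₀) z)
  have hS0 : S x₀ = 1 := by
    ext z
    simp only [hS, hTA0, hTB0, hTN, hf]
    exact hyp.obliqueProj_add_obliqueProj_add_obliqueProj hx₀ z
  have hunit : ∀ᶠ x in 𝓝[M] x₀, IsUnit (S x) := by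
    refine hSc.eventually (Units.isOpen.mem_nhds ?_)
    rw [hS0]
    exact isUnit_one
  have hinv : ContinuousWithinAt (fun x => Ring.inverse (S x)) M x₀ := by
    have h1 := NormedRing.inverse_continuousAt (1 : (E →L[ℝ] E)ˣ)
    rw [Units.val_one, ← hS0] at h1
    exact h1.comp_continuousWithinAt hSc
  have hmemA : ∀ x z, TA x z ∈ Lm x := fun x z => Submodule.starProjection_apply_mem _ _
  have hmemB : ∀ x z, TB x z ∈ Lp x := fun x z => Submodule.starProjection_apply_mem _ _
  have hmemN : ∀ x z, TN x z ∈ neutralSpace v x := fun x z =>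
    Submodule.smul_mem _ _ (Submodule.mem_span_singleton_self _)
  have key : ∀ (Q T : E → E →L[ℝ] E), ContinuousWithinAt T M x₀ →
      (∀ x ∈ M, ∀ z, Q x (TA x z + TB x z + TN x z) = T x z) → ContinuousWithinAt Q M x₀ := by
    intro Q T hT hQ
    have heq : ∀ x ∈ M, IsUnit (S x) → Q x = T x * Ring.inverse (S x) := by
      intro x hx hu
      have h1 : Q x * S x = T x := by
        ext z
        exact hQ x hx z
      rw [← h1, mul_assoc, Ring.mul_inverse_cancel _ hu, mul_one]
    refine (hT.mul hinv).congr_of_eventuallyEq ?_ (heq x₀ hx₀ (hS0 ▸ isUnit_one))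
    filter_upwards [hunit, self_mem_nhdsWithin] with x hu hx
    exact heq x hx hu
  exact ⟨key _ TA hTAc fun x hx z =>
      hyp.obliqueProj_minus_add_add hx (hmemA x z) (hmemB x z) (hmemN x z),
    key _ TB hTBc fun x hx z =>
      hyp.obliqueProj_plus_add_add hx (hmemA x z) (hmemB x z) (hmemN x z),
    key _ TN hTNc fun x hx z =>
      hyp.obliqueProj_zero_add_add hx (hmemA x z) (hmemB x z) (hmemN x z)⟩

/-- Continuity on the compact M bounds the set of norms, so that `sSup` is a genuine upper bound. -/
theorem mul_norm_obliqueProj_le_greenConst (hyp : IsHyperbolicAlong v χ M Lm Lp c α)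
    (hv : Continuous v) (hM : IsCompact M) (hx : x ∈ M) :
    c * ‖obliqueProj (Lm x) (Lp x ⊔ neutralSpace v x)‖ ≤ greenConst v M Lm Lp c ∧
    c * ‖obliqueProj (Lp x) (Lm x ⊔ neutralSpace v x)‖ ≤ greenConst v M Lm Lp c ∧
    c * ‖obliqueProj (neutralSpace v x) (Lm x ⊔ Lp x)‖ ≤ greenConst v M Lm Lp c := by
  obtain ⟨h1, h2, h3⟩ := hyp.continuousOn_obliqueProj hv
  have hbdd := ((hM.image_of_continuousOn h1.norm).bddAbove.union
    (hM.image_of_continuousOn h2.norm).bddAbove).union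
    (hM.image_of_continuousOn h3.norm).bddAbove
  have hc : 0 ≤ c := zero_le_one.trans hyp.one_le
  exact ⟨mul_le_mul_of_nonneg_left
      (le_csSup hbdd (.inl (.inl (mem_image_of_mem _ hx)))) hc,
    mul_le_mul_of_nonneg_left (le_csSup hbdd (.inl (.inr (mem_image_of_mem _ hx)))) hc,
    mul_le_mul_of_nonneg_left (le_csSup hbdd (.inr (mem_image_of_mem _ hx))) hc⟩

/-- Along an orbit in a hyperbolic invariant set, the variational equation is split by the stable
projection. -/
theorem isExponentialSplitting (hyp : IsHyperbolicAlong v χ M Lm Lp c α)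
    (hχ : GeneratesFlow v χ) (hv : Continuous v) (hM : IsCompact M)
    (hinv : ∀ t, ∀ x ∈ M, χ t x ∈ M)
    (hc : ∀ t : ℝ, ∀ x ∈ M, ∀ η ∈ neutralSpace v x, ‖flowDeriv χ t x η‖ ≤ c * ‖η‖)
    {ξ : E} (hξ : ξ ∈ M) {U Z : ℝ → E →L[ℝ] E} (hU0 : U 0 = 1) (hUc : Continuous U)
    (hZc : Continuous Z) (hZU : ∀ t, Z t * U t = 1) (hUZ : ∀ t, U t * Z t = 1)
    (hU : ∀ t, 0 ≤ t → HasFDerivAt (χ t) (U t) ξ)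
    (hZ : ∀ t, 0 ≤ t → HasFDerivAt (χ (-t)) (Z t) (χ t ξ)) :
    IsExponentialSplitting U Z (obliqueProj (Lm ξ) (Lp ξ ⊔ neutralSpace v ξ))
      (greenConst v M Lm Lp c) α := by
  have hc0 : 0 ≤ c := zero_le_one.trans hyp.one_le
  have hder : ∀ s t, 0 ≤ s → 0 ≤ t → flowDeriv χ (t - s) (χ s ξ) = U t * Z s := by
    intro s t hs ht
    have hback : χ (-s) (χ s ξ) = ξ := by
      rw [← χ.map_add, neg_add_cancel, χ.map_zero_apply]
    have h1 : HasFDerivAt (χ t) (U t) (χ (-s) (χ s ξ)) := by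
      rw [hback]
      exact hU t ht
    refine ((h1.comp _ (hZ s hs)).congr_of_eventuallyEq (Eventually.of_forall fun y => ?_)).fderiv
    rw [Function.comp_apply, ← χ.map_add, sub_eq_add_neg]
  have hflow : ∀ s, 0 ≤ s → flowDeriv χ s ξ = U s := fun s hs => (hU s hs).fderiv
  have hmapm : ∀ s, 0 ≤ s → ∀ a ∈ Lm ξ, U s a ∈ Lm (χ s ξ) := fun s hs a ha => by
    rw [← hyp.map_minus s ξ hξ, ← hflow s hs]
    exact Submodule.mem_map_of_mem ha
  have hmapp : ∀ s, 0 ≤ s → ∀ a ∈ Lp ξ, U s a ∈ Lp (χ s ξ) := fun s hs a ha => by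
    rw [← hyp.map_plus s ξ hξ, ← hflow s hs]
    exact Submodule.mem_map_of_mem ha
  have hmap0 : ∀ s, 0 ≤ s → ∀ a ∈ neutralSpace v ξ, U s a ∈ neutralSpace v (χ s ξ) := by
    intro s hs a ha
    obtain ⟨b, rfl⟩ := Submodule.mem_span_singleton.1 ha
    -- Differentiating χ^s ∘ χ^τ = χ^τ ∘ χ^s at τ = 0 shows that the derivative of the flow carries
    -- v(ξ) to v(χ^s ξ).
    have h1 : HasDerivAt (fun τ => χ s (χ τ ξ)) (U s (v ξ)) 0 := by
      have h2 := hχ ξ 0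
      have h3 : HasFDerivAt (χ s) (U s) (χ 0 ξ) := by
        rw [χ.map_zero_apply]
        exact hU s hs
      rw [χ.map_zero_apply] at h2
      exact h3.comp_hasDerivAt 0 h2
    have h4 : (fun τ => χ s (χ τ ξ)) = fun τ => χ τ (χ s ξ) := by
      ext τ
      rw [← χ.map_add, ← χ.map_add, add_comm]
    have h5 := hχ (χ s ξ) 0
    rw [h4] at h1
    rw [map_smul, h1.unique h5, χ.map_zero_apply]
    exact Submodule.smul_mem _ _ (Submodule.mem_span_singleton_self _)
  set A := obliqueProj (Lm ξ) (Lp ξ ⊔ neutralSpace v ξ) with hA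
  set B := obliqueProj (Lp ξ) (Lm ξ ⊔ neutralSpace v ξ) with hB
  set N := obliqueProj (neutralSpace v ξ) (Lm ξ ⊔ Lp ξ) with hN
  have hAmem : ∀ z, A z ∈ Lm ξ := obliqueProj_mem (hyp.isCompl_minus ξ hξ)
  have hBmem : ∀ z, B z ∈ Lp ξ := obliqueProj_mem (hyp.isCompl_plus ξ hξ)
  have hNmem : ∀ z, N z ∈ neutralSpace v ξ := obliqueProj_mem (hyp.isCompl_zero ξ hξ)
  have hsum : ∀ z, A z + B z + N z = z := hyp.obliqueProj_add_obliqueProj_add_obliqueProj hξ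
  have hUZx : ∀ s z, U s (Z s z) = z := fun s z =>
    congrArg (fun B : E →L[ℝ] E => B z) (hUZ s)
  have hZUx : ∀ s z, Z s (U s z) = z := fun s z =>
    congrArg (fun B : E →L[ℝ] E => B z) (hZU s)
  have hdecomp : ∀ s z, z = U s (A (Z s z)) + U s (B (Z s z)) + U s (N (Z s z)) := fun s z => by
    rw [← map_add, ← map_add, hsum, hUZx]
  -- Invariance makes the projections at χ^s ξ the conjugates by U s of those at ξ. The kernels thus
  -- become the derivative of χ^{t-s} at χ^s ξ composed with projections there, where the hyperbolic
  -- estimates apply.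
  have hPA : ∀ s, 0 ≤ s → ∀ z, obliqueProj (Lm (χ s ξ)) (Lp (χ s ξ) ⊔ neutralSpace v (χ s ξ)) z =
      U s (A (Z s z)) := fun s hs z => by
    conv_lhs => rw [hdecomp s z]
    exact hyp.obliqueProj_minus_add_add (hinv s ξ hξ) (hmapm s hs _ (hAmem _))
      (hmapp s hs _ (hBmem _)) (hmap0 s hs _ (hNmem _))
  have hPB : ∀ s, 0 ≤ s → ∀ z, obliqueProj (Lp (χ s ξ)) (Lm (χ s ξ) ⊔ neutralSpace v (χ s ξ)) z =
      U s (B (Z s z)) := fun s hs z => by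
    conv_lhs => rw [hdecomp s z]
    exact hyp.obliqueProj_plus_add_add (hinv s ξ hξ) (hmapm s hs _ (hAmem _))
      (hmapp s hs _ (hBmem _)) (hmap0 s hs _ (hNmem _))
  have hPN : ∀ s, 0 ≤ s → ∀ z, obliqueProj (neutralSpace v (χ s ξ)) (Lm (χ s ξ) ⊔ Lp (χ s ξ)) z =
      U s (N (Z s z)) := fun s hs z => by
    conv_lhs => rw [hdecomp s z]
    exact hyp.obliqueProj_zero_add_add (hinv s ξ hξ) (hmapm s hs _ (hAmem _))
      (hmapp s hs _ (hBmem _)) (hmap0 s hs _ (hNmem _))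
  have hbound : ∀ Q : E →L[ℝ] E, c * ‖Q‖ ≤ greenConst v M Lm Lp c →
      ∀ e : ℝ, 0 ≤ e → ∀ y z : E, ‖y‖ ≤ c * e * ‖Q z‖ → ‖y‖ ≤ greenConst v M Lm Lp c * e * ‖z‖ := by
    intro Q hQ e he y z hy
    refine hy.trans ?_
    calc c * e * ‖Q z‖ ≤ c * e * (‖Q‖ * ‖z‖) :=
          mul_le_mul_of_nonneg_left (Q.le_opNorm z) (mul_nonneg hc0 he)
      _ = c * ‖Q‖ * (e * ‖z‖) := by ring
      _ ≤ greenConst v M Lm Lp c * (e * ‖z‖) :=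
          mul_le_mul_of_nonneg_right hQ (by positivity)
      _ = _ := by ring
  have hK0 : 0 ≤ greenConst v M Lm Lp c :=
    (mul_nonneg hc0 (norm_nonneg _)).trans
      (hyp.mul_norm_obliqueProj_le_greenConst hv hM hξ).1
  refine ⟨hUc, hZc, hU0, hUZ, hZU, ?_, hyp.rate_pos, fun s t hs hst => ?_, fun s t ht hts => ?_⟩
  · ext z
    have := obliqueProj_add (hyp.isCompl_minus ξ hξ) (hAmem z) (Submodule.zero_mem _)
    rwa [add_zero] at this
  · refine ContinuousLinearMap.opNorm_le_bound _ (by positivity) fun z => ?_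
    obtain ⟨hQ, -, -⟩ := hyp.mul_norm_obliqueProj_le_greenConst hv hM (hinv s ξ hξ)
    refine hbound _ hQ _ (Real.exp_pos _).le _ z ?_
    have h1 := hyp.estimate_minus (t - s) (sub_nonneg.2 hst) _ (hinv s ξ hξ) _
      (obliqueProj_mem (hyp.isCompl_minus _ (hinv s ξ hξ)) z)
    rw [hder s t hs (hs.trans hst)] at h1
    refine le_trans (le_of_eq ?_) h1
    rw [hPA s hs z]
    simp only [ContinuousLinearMap.mul_def, ContinuousLinearMap.comp_apply, hZUx]
  · have hs : 0 ≤ s := ht.trans hts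
    refine ContinuousLinearMap.opNorm_le_bound _ (by positivity) fun z => ?_
    obtain ⟨-, hQp, hQ0⟩ := hyp.mul_norm_obliqueProj_le_greenConst hv hM (hinv s ξ hξ)
    have h1 := hyp.estimate_plus (t - s) (sub_nonpos.2 hts) _ (hinv s ξ hξ) _
      (obliqueProj_mem (hyp.isCompl_plus _ (hinv s ξ hξ)) z)
    have h2 := hc (t - s) _ (hinv s ξ hξ) _
      (obliqueProj_mem (hyp.isCompl_zero _ (hinv s ξ hξ)) z)
    have h1' := hbound _ hQp _ (Real.exp_pos _).le _ z h1
    have h2' := hbound _ hQ0 1 zero_le_one _ z (by rwa [mul_one])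
    have h3 : (U t * (1 - A) * Z s) z = flowDeriv χ (t - s) (χ s ξ)
        (obliqueProj (Lp (χ s ξ)) (Lm (χ s ξ) ⊔ neutralSpace v (χ s ξ)) z) +
        flowDeriv χ (t - s) (χ s ξ)
        (obliqueProj (neutralSpace v (χ s ξ)) (Lm (χ s ξ) ⊔ Lp (χ s ξ)) z) := by
      rw [hder s t hs ht, hPB s hs, hPN s hs]
      simp only [ContinuousLinearMap.mul_def, ContinuousLinearMap.comp_apply, hZUx]
      rw [← map_add]
      congr 1
      have := hsum (Z s z)
      rw [add_assoc] at this
      exact sub_eq_iff_eq_add'.2 this.symm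
    rw [h3]
    refine (norm_add_le _ _).trans ((add_le_add h1' h2').trans_eq ?_)
    ring

end IsHyperbolicAlong

/-! ### The family of fibres over M -/

theorem fderiv_remainder {E : Type*} [NormedAddCommGroup E] [InnerProductSpace ℝ E] {v : E → E}
    (hv : Differentiable ℝ v) (χ : Flow ℝ E) (t : ℝ) (ξ y : E) :
    fderiv ℝ (fun z => remainder v χ t z ξ) y =
      fderiv ℝ v (χ t ξ + y) - fderiv ℝ v (χ t ξ) := by
  have h1 : HasFDerivAt (fun z => v (χ t ξ + z)) (fderiv ℝ v (χ t ξ + y)) y := by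
    simpa [Function.comp_def] using (hv (χ t ξ + y)).hasFDerivAt.comp y ((hasFDerivAt_id y).const_add (χ t ξ))
  exact ((h1.sub_const _).sub (fderiv ℝ v (χ t ξ)).hasFDerivAt).fderiv

theorem proposition2 {E : Type*} [NormedAddCommGroup E] [InnerProductSpace ℝ E]
    [FiniteDimensional ℝ E]
    (v : E → E) (hv : ContDiff ℝ 2 v) (χ : Flow ℝ E) (hχ : GeneratesFlow v χ)
    (D M : Set E) (m : ℕ) (hM : IsAttractingInvariantManifold χ D M m)
    (Lm Lp : E → Submodule ℝ E) (c α : ℝ) (hyp : IsHyperbolicAlong v χ M Lm Lp c α)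
    (hc : ∀ t : ℝ, ∀ x ∈ M, ∀ η ∈ neutralSpace v x, ‖flowDeriv χ t x η‖ ≤ c * ‖η‖)
    (C : ℝ) (hC : 0 < C) (hw : IsRemainderBound v χ M C)
    (r R : ℝ) (hr : 0 < r) (hR : 0 < R) (hR1 : R < 1)
    (hrR : c * r + 11 / (6 * α) * greenConst v M Lm Lp c * C * R ^ 2 ≤ R)
    (hRK : 11 / (3 * α) * greenConst v M Lm Lp c * C * R < 1) :
    ∃ C₀ : ℝ, 0 < C₀ ∧ ∃ h : E × E → E,
      ContinuousOn h (stableDiscBundle M Lm r) ∧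
      (∀ ξ η : E, (ξ, η) ∈ stableDiscBundle M Lm r →
        h (ξ, η) ∈ Lp ξ ⊔ neutralSpace v ξ ∧
        ‖h (ξ, η)‖ ≤ C₀ * ‖η‖ ^ 2 ∧
        ∀ t : ℝ, 0 ≤ t →
          ‖χ t (ξ + η + h (ξ, η)) - χ t ξ‖ ≤ R * Real.exp (-α * t)) ∧
      (∀ ξ ∈ M, ContDiffOn ℝ 2 (fun η : Lm ξ => h (ξ, (η : E))) (Metric.ball 0 r)) := by
  have hc0 : 0 ≤ c := zero_le_one.trans hyp.one_le
  have hα := hyp.rate_pos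
  have hinv : ∀ t, ∀ x ∈ M, χ t x ∈ M := fun t x hx => by
    have := mem_image_of_mem (fun x => χ t x) hx
    rwa [hM.invariant t] at this
  obtain ⟨B, hB⟩ : ∃ B : ℝ, ∀ x ∈ M, ‖x‖ ≤ B := hM.isCompact.isBounded.exists_norm_le
  set K := greenConst v M Lm Lp c with hKdef
  have hRK' : 2 * (11 / (6 * α) * K * C * R) < 1 := by
    have : 2 * (11 / (6 * α) * K * C * R) = 11 / (3 * α) * K * C * R := by
      field_simp
      ring
    linarith
  set A : E → E →L[ℝ] E := fun ξ => obliqueProj (Lm ξ) (Lp ξ ⊔ neutralSpace v ξ) with hA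
  have hfix : ∀ ξ ∈ M, ∀ η, η ∈ Lm ξ → A ξ η = η := fun ξ hξ η hη => by
    have := obliqueProj_add (hyp.isCompl_minus ξ hξ) hη (Submodule.zero_mem _)
    rwa [add_zero] at this
  have hmem : ∀ ξ ∈ M, ∀ η, A ξ η = η → η ∈ Lm ξ := fun ξ hξ η hη =>
    hη ▸ obliqueProj_mem (hyp.isCompl_minus ξ hξ) η
  have hfibre : ∀ ξ ∈ M, ∃ k : E → E, (∀ η, A ξ η = η → ‖η‖ < r → A ξ (k η) = 0 ∧
        ‖k η‖ ≤ 11 / (6 * α) * K * C * (2 * c) ^ 2 * ‖η‖ ^ 2 ∧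
        (∀ t, 0 ≤ t → ‖χ t (ξ + η + k η) - χ t ξ‖ ≤ R * Real.exp (-α * t)) ∧
        ∀ k', A ξ k' = 0 → (∀ t, 0 ≤ t →
          ‖χ t (ξ + η + k') - χ t ξ‖ ≤ R * Real.exp (-α * t)) → k' = k η) ∧
      ∀ L : Submodule ℝ E, (∀ η ∈ L, A ξ η = η) →
        ContDiffOn ℝ 2 (fun η : L => k η) (Metric.ball 0 r) := by
    intro ξ hξ
    obtain ⟨U, Z, hU0, hU, hZ, hZU, hUZ, hUd, hZd⟩ := hχ.exists_fundamental_solution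
      (hv.of_le (by norm_num)) (fun t => hB _ (hinv t ξ hξ))
    refine exists_stable_fibre hχ hv (fun t => hB _ (hinv t ξ hξ))
      (hyp.isExponentialSplitting hχ hv.continuous hM.isCompact hinv hc hξ hU0
        (continuous_iff_continuousAt.2 fun t => (hU t).continuousAt)
        (continuous_iff_continuousAt.2 fun t => (hZ t).continuousAt) hZU hUZ hUd hZd)
      hU hZ hc0 (fun η hη t ht => ?_) hC.le (fun t _ y hy => ?_) hR.le hR1 hrR hRK'
    · rw [← (hUd t ht).fderiv]
      exact hyp.estimate_minus t ht ξ hξ η (hmem ξ hξ η hη)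
    · rw [← fderiv_remainder (hv.differentiable (by norm_num))]
      exact (hw t ξ hξ y hy).2.1
  choose! k hk hk2 using hfibre
  have hN : ∀ q ∈ stableDiscBundle M Lm r, A q.1 (k q.1 q.2) = 0 ∧
      ‖k q.1 q.2‖ ≤ 11 / (6 * α) * K * C * (2 * c) ^ 2 * ‖q.2‖ ^ 2 ∧
      (∀ t, 0 ≤ t → ‖χ t (q.1 + q.2 + k q.1 q.2) - χ t q.1‖ ≤ R * Real.exp (-α * t)) ∧
      ∀ k', A q.1 k' = 0 → (∀ t, 0 ≤ t →
        ‖χ t (q.1 + q.2 + k') - χ t q.1‖ ≤ R * Real.exp (-α * t)) → k' = k q.1 q.2 :=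
    fun q hq => hk q.1 hq.1 q.2 (hfix q.1 hq.1 q.2 hq.2.1) hq.2.2
  refine ⟨|11 / (6 * α) * K * C * (2 * c) ^ 2| + 1, by positivity, fun q => k q.1 q.2, ?_,
    fun ξ η hq => ?_, fun ξ hξ => hk2 ξ hξ (Lm ξ) (hfix ξ hξ)⟩
  · intro q₀ hq₀
    -- The values lie in a compact ball. Any cluster point at q₀ inherits the vanishing stable
    -- component and the decay bound with the same R, so uniqueness identifies it with the value at
    -- q₀.
    refine (isCompact_closedBall (0 : E) (R + r)).tendsto_nhds_of_unique_mapClusterPt ?_ ?_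
    · filter_upwards [self_mem_nhdsWithin] with q hq
      rw [mem_closedBall_zero_iff]
      have h1 := (hN q hq).2.2.1 0 le_rfl
      rw [χ.map_zero_apply, χ.map_zero_apply, mul_zero, Real.exp_zero, mul_one] at h1
      have h2 : k q.1 q.2 = (q.1 + q.2 + k q.1 q.2 - q.1) - q.2 := by abel
      rw [h2]
      exact (norm_sub_le _ _).trans (add_le_add h1 hq.2.2.le)
    · intro y _ hy
      obtain ⟨F, hF, hFy⟩ := mapClusterPt_iff_ultrafilter.1 hy
      have hmemF : ∀ᶠ q in (F : Filter (E × E)), q ∈ stableDiscBundle M Lm r :=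
        hF self_mem_nhdsWithin
      have hFid : Tendsto id (F : Filter (E × E)) (𝓝 q₀) := hF.trans nhdsWithin_le_nhds
      have hF1 : Tendsto (fun q : E × E => q.1) F (𝓝 q₀.1) :=
        (continuous_fst.tendsto q₀).comp hFid
      have hF2 : Tendsto (fun q : E × E => q.2) F (𝓝 q₀.2) :=
        (continuous_snd.tendsto q₀).comp hFid
      refine (hN q₀ hq₀).2.2.2 y ?_ fun t ht => ?_
      · have hF1' : Tendsto (fun q : E × E => q.1) F (𝓝[M] q₀.1) :=
          tendsto_nhdsWithin_iff.2 ⟨hF1, hmemF.mono fun q hq => hq.1⟩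
        have hA0 : Tendsto (fun q : E × E => A q.1) F (𝓝 (A q₀.1)) :=
          ((hyp.continuousOn_obliqueProj hv.continuous).1 q₀.1 hq₀.1).tendsto.comp hF1'
        have happly : Continuous fun z : (E →L[ℝ] E) × E => z.1 z.2 := by fun_prop
        refine tendsto_nhds_unique ((happly.tendsto (A q₀.1, y)).comp (hA0.prodMk_nhds hFy))
          (tendsto_const_nhds.congr' (hmemF.mono fun q hq => (hN q hq).1.symm))
      · have hcont : Continuous (χ t) := χ.continuous_toFun t
        have h1 : Tendsto (fun q : E × E => ‖χ t (q.1 + q.2 + k q.1 q.2) - χ t q.1‖) F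
            (𝓝 ‖χ t (q₀.1 + q₀.2 + y) - χ t q₀.1‖) :=
          (((hcont.tendsto _).comp ((hF1.add hF2).add hFy)).sub ((hcont.tendsto _).comp hF1)).norm
        exact le_of_tendsto h1 (hmemF.mono fun q hq => (hN q hq).2.2.1 t ht)
  · obtain ⟨h1, h2, h3, -⟩ := hN (ξ, η) hq
    refine ⟨mem_of_obliqueProj_eq_zero (hyp.isCompl_minus ξ hq.1) h1, h2.trans ?_, h3⟩
    refine mul_le_mul_of_nonneg_right ?_ (by positivity)
    exact (le_abs_self _).trans (le_add_of_nonneg_right zero_le_one)
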